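/- Let $(\mathcal X,d)$ be a metric space that is geometrically doubling: there is $N_0\in\mathbb N$ such that every ball $B(x,r):=\{y:d(x,y)<r\}$, $r\in(0,\infty)$, is covered by at most $N_0$ balls of radius $r/2$. Let $\mu$ be a Borel measure on $\mathcal X$ that is upper doubling: there are $\lambda:\mathcal X\times(0,\infty)\to(0,\infty)$ and $C_{(\lambda)}>0$ such that $r\mapsto\lambda(x,r)$ is non-decreasing, $\mu(B(x,r))\le\lambda(x,r)\le C_{(\lambda)}\lambda(x,r/2)$ for all $x\in\mathcal X$, $r>0$, and $\lambda(x,r)\le C_{(\lambda)}\lambda(y,r)$ whenever $d(x,y)\le r$. A ball $B=B(c_B,r_B)$ is understood to come with its center and radius, and $\rho B:=B(c_B,\rho r_B)$. For $\eta\in(1,\infty)$ and balls $B\subset S$ let $$\widetilde K^{(\eta)}_{B,S}:=1+\sum_{k=-\lfloor\log_\eta2\rfloor}^{N^{(\eta)}_{B,S}}\frac{\mu(\eta^kB)}{\lambda(c_B,\eta^kr_B)},$$ where $N^{(\eta)}_{B,S}$ is the smallest integer $N$ with $\eta^Nr_B\ge r_S$. Fix $\eta\in(1,\infty)$ and $\gamma\in[1,\infty)$.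 For a scalar (real or complex) function $f\in L^1_{\rm loc}(\mu)$, numbers $\{f_B\}_B$ indexed by the balls are called admissible with constant $A\ge0$ if $$\frac1{\mu(\eta B)}\int_B|f-f_B|\,d\mu\le A\quad\text{for all balls }B,\qquad |f_B-f_S|\le A\,[\widetilde K^{(\eta)}_{B,S}]^\gamma\quad\text{for all balls }B\subset S$$ (a mean with $\mu(\eta B)=0$ is read as $0$). The function $f$ belongs to $\widetilde{\rm RBMO}(\mu)$ if some family is admissible with some constant $A>0$, and $\|f\|$ denotes the infimum of all such $A$. Let $\rho\in(1,\infty)$. Then the following hold. (0) For every $f\in\widetilde{\rm RBMO}(\mu)$ there is a family $\{f_B\}_B$ admissible with constant $\|f\|$. (1) (Proposition 2.16, John–Nirenberg inequality) There is a constant $c>0$ such that, for all $f\in\widetilde{\rm RBMO}(\mu)$, all families $\{f_B\}_B$ admissible with constant $\|f\|$, all balls $B_0$ and all $t\in(0,\infty)$, $$\mu(\{x\in B_0:|f(x)-f_{B_0}|>t\})\le2\mu(\rho B_0)\,e^{-ct/\|f\|},$$ where the exponential is read as $0$ if $\|f\|=0$. More generally, with the same $c$, for every $A>0$ and every family $\{f_B\}_B$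 admissible for $f$ with constant $A$, the inequality holds with $A$ in place of $\|f\|$. (2) (Corollary 2.17) For every $p\in[1,\infty)$ there is a constant $C>0$ such that, for all $f\in\widetilde{\rm RBMO}(\mu)$, all families $\{f_B\}_B$ admissible with constant $\|f\|$ and all balls $B$, $$\Big[\frac1{\mu(\rho B)}\int_B|f-f_B|^p\,d\mu\Big]^{1/p}\le C\|f\|$$ (the mean is read as $0$ if $\mu(\rho B)=0$); likewise, with the same $C$, with $A$ in place of $\|f\|$ for every family admissible for $f$ with constant $A>0$. -/

import Mathlib

open MeasureTheory Metric
open scoped ENNReal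

/-- A metric space is geometrically doubling if, for some natural number `N₀`, every ball of
radius `r` is covered by at most `N₀` balls of radius `r / 2`. -/
def GeometricallyDoubling (X : Type*) [MetricSpace X] : Prop :=
  ∃ N₀ : ℕ, ∀ (x : X) (r : ℝ), 0 < r →
    ∃ s : Finset X, s.card ≤ N₀ ∧ ball x r ⊆ ⋃ y ∈ s, ball y (r / 2)

/-- `lam : X × (0,∞) → (0,∞)` is a dominating function of `μ` with constant `Clam`, with the
comparability of its values at nearby centres. Only the values `lam x r` with `0 < r` matter. -/
structure IsDominatingFunction {X : Type*} [MetricSpace X] [MeasurableSpace X]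
    (μ : Measure X) (lam : X → ℝ → ℝ) (Clam : ℝ) : Prop where
  const_pos : 0 < Clam
  pos : ∀ (x : X) (r : ℝ), 0 < r → 0 < lam x r
  mono : ∀ (x : X) (r s : ℝ), 0 < r → r ≤ s → lam x r ≤ lam x s
  measure_ball_le : ∀ (x : X) (r : ℝ), 0 < r → μ (ball x r) ≤ ENNReal.ofReal (lam x r)
  doubling : ∀ (x : X) (r : ℝ), 0 < r → lam x r ≤ Clam * lam x (r / 2)
  comparable : ∀ (x y : X) (r : ℝ), 0 < r → dist x y ≤ r → lam x r ≤ Clam * lam y r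

/-- The smallest integer `N` with `η ^ N * r ≥ s`; see `isLeast_ballGap`. -/
noncomputable def ballGap (η r s : ℝ) : ℤ := ⌈Real.logb η (s / r)⌉

theorem isLeast_ballGap {η r s : ℝ} (hη : 1 < η) (hr : 0 < r) (hs : 0 < s) :
    IsLeast {N : ℤ | s ≤ η ^ N * r} (ballGap η r s) := by
  have key : ∀ N : ℤ, s ≤ η ^ N * r ↔ ballGap η r s ≤ N := by
    intro N
    rw [ballGap, Int.ceil_le, Real.logb_le_iff_le_rpow hη (div_pos hs hr), Real.rpow_intCast,
      div_le_iff₀ hr]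
  exact ⟨(key _).2 le_rfl, fun N hN => (key N).1 hN⟩

/-- The discrete coefficient `K̃_{B,S}^{(η)}` of the balls `B = B(x, r) ⊆ S`, where `s` is the
radius of `S`:
`1 + ∑_{k = -⌊log_η 2⌋}^{N} μ(η^k B) / lam(x, η^k r)`, with `N = ballGap η r s`. -/
noncomputable def discreteCoeff {X : Type*} [MetricSpace X] [MeasurableSpace X]
    (μ : Measure X) (lam : X → ℝ → ℝ) (η : ℝ) (x : X) (r s : ℝ) : ℝ :=
  1 + ∑ k ∈ Finset.Icc (-⌊Real.logb η 2⌋) (ballGap η r s),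
    μ.real (ball x (η ^ k * r)) / lam x (η ^ k * r)

/-- The numbers `fB x r` (one for each ball `B(x, r)`) and the constant `A` are admissible in the
definition of the regularized BMO space with discrete coefficient, with parameters `η` and `γ`.
A ball carries its centre and its radius; inclusion of balls is inclusion of sets. -/
structure IsRBMOFamily {X : Type*} [MetricSpace X] [MeasurableSpace X] {𝕜 : Type*} [RCLike 𝕜]
    (μ : Measure X) (lam : X → ℝ → ℝ) (η γ : ℝ) (f : X → 𝕜) (fB : X → ℝ → 𝕜) (A : ℝ) :
    Prop where
  oscillation : ∀ (x : X) (r : ℝ), 0 < r →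
    (μ (ball x (η * r)))⁻¹ * ∫⁻ y in ball x r, ‖f y - fB x r‖ₑ ∂μ ≤ ENNReal.ofReal A
  regular : ∀ (x y : X) (r s : ℝ), 0 < r → 0 < s → ball x r ⊆ ball y s →
    ‖fB x r - fB y s‖ ≤ A * (discreteCoeff μ lam η x r s) ^ γ

/-- Membership in the space `RBMO~_{η,γ}(μ)`. -/
def MemRBMO {X : Type*} [MetricSpace X] [MeasurableSpace X] {𝕜 : Type*} [RCLike 𝕜]
    (μ : Measure X) (lam : X → ℝ → ℝ) (η γ : ℝ) (f : X → 𝕜) : Prop :=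
  LocallyIntegrable f μ ∧ ∃ A : ℝ, 0 < A ∧ ∃ fB : X → ℝ → 𝕜, IsRBMOFamily μ lam η γ f fB A

/-- The norm of `RBMO~_{η,γ}(μ)`: the infimum of the admissible positive constants. -/
noncomputable def rbmoNorm {X : Type*} [MetricSpace X] [MeasurableSpace X]
    {𝕜 : Type*} [RCLike 𝕜] (μ : Measure X) (lam : X → ℝ → ℝ) (η γ : ℝ) (f : X → 𝕜) : ℝ :=
  sInf {A : ℝ | 0 < A ∧ ∃ fB : X → ℝ → 𝕜, IsRBMOFamily μ lam η γ f fB A}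

/-- `e ^ (-s / A)` for `s > 0` and `A ≥ 0`, read as `e ^ (-∞) = 0` when `A = 0`. -/
noncomputable def expDecay (s A : ℝ) : ℝ≥0∞ :=
  if A = 0 then 0 else ENNReal.ofReal (Real.exp (-s / A))

/-!
The John–Nirenberg inequality follows from a stopping-time argument in which doubling balls take
the part of dyadic cubes. Fix `α = η ^ M` large and `β` large in terms of `α`, and call `B` doubling
if `μ (α B) ≤ β μ B`. Three facts make these balls work.

* As `β` exceeds the covering number of balls by balls `α` times smaller, almost every point is the
  centre of arbitrarily small doubling balls of the prescribed radii `r₀ / α ^ i`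
  (`ae_frequently_isDoublingBall`). They form a Vitali family, so that Lebesgue's differentiation
  theorem holds along them (`ae_frequently_lintegral_sub_le`); since `η ≤ α`, it says that `f_B` is
  within a bounded multiple of `A` of `f(x)` for small doubling `B` about `x`.
* As `β` also exceeds twice the growth factor of `lam` under dilation by `α`, the discrete
  coefficient of two concentric balls without doubling balls in between is bounded
  (`discreteCoeff_le_of_not_isDoublingBall`). Thus `f_B` changes by at most a multiple of `A` from a
  doubling ball to the next larger one. This is the only way in which the coefficient enters, so the
  power `γ` affects the constants alone.
* The oscillation over a slight dilate of `B₀` is at most a multiple of `A μ(ρ B₀)`, also for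
  `ρ < η` (`lintegral_norm_sub_dilate_le`).

For `L` a large multiple of `A`, almost every `x ∈ B₀` with `|f(x) - f_{B₀}| > 2 L` is thus the
centre of a largest doubling ball `B` with `|f_B - f_{B₀}| > L`, and then `|f_{5B} - f_{B₀}| ≤ 2 L`
(`exists_stopping_ball`). Vitali's covering lemma extracts disjoint stopping balls whose fivefold
dilates cover all these points. Since `f` is at distance at least `L / 2` from `f_{B₀}` in the mean
over each of them, the third fact bounds the sum of the `μ(5 ρ B)` by `μ(ρ B₀) / 2`. Iterating,
`μ {x ∈ B₀ : |f - f_{B₀}| > 2 k L} ≤ 2 ^ (-k) μ(ρ B₀)` (`measure_lt_norm_sub_le_half_pow`), which is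
exponential decay. Integrating it gives the `L^p` bounds, and constants that vanish are limits of
positive ones. The infimum in the norm is attained because a minimizing sequence of admissible
families is bounded at each ball and has a pointwise limit along an ultrafilter
(`exists_isRBMOFamily_of_tendsto`).
-/

/-! ### Coverings in geometrically doubling spaces -/

theorem exists_finset_cover_div_two_pow {X : Type*} [MetricSpace X] {N₀ : ℕ}
    (h : ∀ (x : X) (r : ℝ), 0 < r →
      ∃ s : Finset X, s.card ≤ N₀ ∧ ball x r ⊆ ⋃ y ∈ s, ball y (r / 2)) (n : ℕ) (x : X) {r : ℝ}
    (hr : 0 < r) :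
    ∃ s : Finset X, s.card ≤ N₀ ^ n ∧ ball x r ⊆ ⋃ y ∈ s, ball y (r / 2 ^ n) := by
  classical
  induction n with
  | zero => exact ⟨{x}, by simp, by simp⟩
  | succ n ih =>
    obtain ⟨s, hs, hsub⟩ := ih
    choose F hF hFsub using fun y : X => h y (r / 2 ^ n) (by positivity)
    refine ⟨s.biUnion F, ?_, ?_⟩
    · rw [pow_succ]
      exact (Finset.card_biUnion_le_card_mul s F N₀ fun y _ => hF y).trans
        (Nat.mul_le_mul_right _ hs)
    · intro z hz
      obtain ⟨y, hy, hzy⟩ := Set.mem_iUnion₂.1 (hsub hz)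
      obtain ⟨w, hw, hzw⟩ := Set.mem_iUnion₂.1 (hFsub y hzy)
      rw [div_div, ← pow_succ] at hzw
      exact Set.mem_iUnion₂.2 ⟨w, Finset.mem_biUnion.2 ⟨y, hy, hw⟩, hzw⟩

/-- A version of the covering property in which the small balls are centred in the set to be
covered. -/
theorem exists_finset_subset_cover {X : Type*} [MetricSpace X] {N₀ : ℕ}
    (h : ∀ (x : X) (r : ℝ), 0 < r →
      ∃ s : Finset X, s.card ≤ N₀ ∧ ball x r ⊆ ⋃ y ∈ s, ball y (r / 2))
    {α : ℝ} {m : ℕ} (hα : 0 < α) (hm : α ≤ 2 ^ m) (i : ℕ) (x : X) {r : ℝ} (hr : 0 < r)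
    {E : Set X} (hE : E ⊆ ball x r) :
    ∃ s : Finset X, (s : Set X) ⊆ E ∧ s.card ≤ N₀ * (N₀ ^ m) ^ i ∧
      E ⊆ ⋃ y ∈ s, ball y (r / α ^ i) := by
  classical
  obtain ⟨s, hs, hsub⟩ := exists_finset_cover_div_two_pow h (m * i + 1) x hr
  let T : Finset X := s.filter fun y => (E ∩ ball y (r / 2 ^ (m * i + 1))).Nonempty
  have hT : ∀ y ∈ T, (E ∩ ball y (r / 2 ^ (m * i + 1))).Nonempty := fun y hy =>
    (Finset.mem_filter.1 hy).2
  choose! c hc using hT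
  refine ⟨T.image c, ?_, ?_, ?_⟩
  · intro z hz
    obtain ⟨y, hy, rfl⟩ := Finset.mem_image.1 (Finset.mem_coe.1 hz)
    exact (hc y hy).1
  · refine Finset.card_image_le.trans ((Finset.card_filter_le _ _).trans (hs.trans ?_))
    rw [pow_succ, pow_mul, mul_comm]
  · intro z hz
    obtain ⟨y, hy, hzy⟩ := Set.mem_iUnion₂.1 (hsub (hE hz))
    have hyT : y ∈ T := Finset.mem_filter.2 ⟨hy, z, hz, hzy⟩
    refine Set.mem_iUnion₂.2 ⟨c y, Finset.mem_image_of_mem c hyT, ?_⟩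
    have h1 := mem_ball.1 hzy
    have h2 := mem_ball'.1 (hc y hyT).2
    have h3 : r / 2 ^ (m * i) ≤ r / α ^ i := by
      rw [pow_mul]
      gcongr
    have h4 : r / 2 ^ (m * i + 1) + r / 2 ^ (m * i + 1) = r / 2 ^ (m * i) := by
      rw [pow_succ]; field_simp; norm_num
    have h5 := dist_triangle z y (c y)
    rw [mem_ball]
    linarith

theorem GeometricallyDoubling.secondCountableTopology {X : Type*} [MetricSpace X]
    (hX : GeometricallyDoubling X) : SecondCountableTopology X := by
  obtain ⟨N₀, h⟩ := hX
  rcases isEmpty_or_nonempty X with hE | ⟨⟨x₀⟩⟩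
  · infer_instance
  refine secondCountable_of_almost_dense_set fun ε hε => ?_
  choose s hs hsub using fun n k : ℕ =>
    exists_finset_cover_div_two_pow h k x₀ (r := (n : ℝ) + 1) (by positivity)
  refine ⟨⋃ n, ⋃ k, (s n k : Set X),
    Set.countable_iUnion fun n => Set.countable_iUnion fun k => (s n k).countable_toSet, ?_⟩
  intro x
  obtain ⟨n, hn⟩ := exists_nat_gt (dist x x₀)
  obtain ⟨k, hk⟩ := pow_unbounded_of_one_lt (((n : ℝ) + 1) / ε) (one_lt_two)
  obtain ⟨y, hy, hxy⟩ := Set.mem_iUnion₂.1 (hsub n k (mem_ball.2 (by linarith) : x ∈ _))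
  refine ⟨y, Set.mem_iUnion₂.2 ⟨n, k, hy⟩, (mem_ball.1 hxy).le.trans ?_⟩
  rw [div_lt_iff₀ hε] at hk
  rw [div_le_iff₀ (by positivity)]
  linarith

/-! ### Doubling balls of small radius -/

/-- The ball `B(x, r)` is `(α, β)`-doubling for `μ`: the measure of its dilate by the factor `α`
is at most `β` times its own. -/
def IsDoublingBall {X : Type*} [MetricSpace X] [MeasurableSpace X] (μ : Measure X) (α : ℝ)
    (β : NNReal) (x : X) (r : ℝ) : Prop :=
  μ (ball x (α * r)) ≤ β * μ (ball x r)

/-- Almost every point is the centre of arbitrarily small doubling balls. On the set of points all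
of whose balls of radius `r₀ / α ^ i`, `i ≥ k`, fail to be doubling, the measures of these balls
decay like `β ^ (-i)`, whereas `O(P ^ i)` of them cover the set; and `P < β`. -/
theorem ae_frequently_isDoublingBall {X : Type*} [MetricSpace X] [MeasurableSpace X]
    [SecondCountableTopology X] {μ : Measure X} (hfin : ∀ (x : X) (r : ℝ), μ (ball x r) < ∞)
    {α : ℝ} (hα : 1 ≤ α) {N P : ℕ} (hP : 1 ≤ P)
    (hcov : ∀ (i : ℕ) (x : X) (r : ℝ) (E : Set X), 0 < r → E ⊆ ball x r →
      ∃ s : Finset X, (s : Set X) ⊆ E ∧ s.card ≤ N * P ^ i ∧ E ⊆ ⋃ y ∈ s, ball y (r / α ^ i))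
    {β : NNReal} (hβ : 2 * (P : NNReal) ≤ β) {r₀ : ℝ} (hr₀ : 0 < r₀) :
    ∀ᵐ x ∂μ, ∃ᶠ i : ℕ in Filter.atTop, IsDoublingBall μ α β x (r₀ / α ^ i) := by
  have hα0 : 0 < α := by linarith
  have null : ∀ (x₀ : X) (k : ℕ),
      μ {x | x ∈ ball x₀ r₀ ∧ ∀ i, k ≤ i → ¬ IsDoublingBall μ α β x (r₀ / α ^ i)} = 0 := by
    intro x₀ k
    set E := {x | x ∈ ball x₀ r₀ ∧ ∀ i, k ≤ i → ¬ IsDoublingBall μ α β x (r₀ / α ^ i)}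
    have decay : ∀ x ∈ E, ∀ j : ℕ,
        (β : ℝ≥0∞) ^ j * μ (ball x (r₀ / α ^ (k + j))) ≤ μ (ball x₀ (2 * r₀)) := by
      intro x hx j
      induction j with
      | zero =>
        rw [pow_zero, one_mul]
        apply measure_mono
        apply ball_subset_ball'
        have h1 := mem_ball.1 hx.1
        have h2 : r₀ / α ^ (k + 0) ≤ r₀ := div_le_self hr₀.le (one_le_pow₀ hα)
        linarith
      | succ j ih =>
        have h1 := hx.2 (k + (j + 1)) (by omega)
        rw [IsDoublingBall, not_le] at h1
        have h2 : α * (r₀ / α ^ (k + (j + 1))) = r₀ / α ^ (k + j) := by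
          rw [← add_assoc, pow_succ]; field_simp
        rw [h2] at h1
        calc (β : ℝ≥0∞) ^ (j + 1) * μ (ball x (r₀ / α ^ (k + (j + 1))))
            = (β : ℝ≥0∞) ^ j * (β * μ (ball x (r₀ / α ^ (k + (j + 1))))) := by
              rw [pow_succ, mul_assoc]
          _ ≤ (β : ℝ≥0∞) ^ j * μ (ball x (r₀ / α ^ (k + j))) := by gcongr
          _ ≤ _ := ih
    have bound : ∀ j : ℕ, 2 ^ j * μ E ≤ N * (P : ℝ≥0∞) ^ k * μ (ball x₀ (2 * r₀)) := by
      intro j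
      obtain ⟨s, hsE, hcard, hsub⟩ := hcov (k + j) x₀ r₀ E hr₀ fun x hx => hx.1
      have h1 : (β : ℝ≥0∞) ^ j * μ E ≤ (N * P ^ (k + j) : ℕ) * μ (ball x₀ (2 * r₀)) := by
        calc (β : ℝ≥0∞) ^ j * μ E
            ≤ (β : ℝ≥0∞) ^ j * ∑ y ∈ s, μ (ball y (r₀ / α ^ (k + j))) := by
              gcongr
              exact (measure_mono hsub).trans (measure_biUnion_finset_le _ _)
          _ = ∑ y ∈ s, (β : ℝ≥0∞) ^ j * μ (ball y (r₀ / α ^ (k + j))) := Finset.mul_sum _ _ _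
          _ ≤ ∑ y ∈ s, μ (ball x₀ (2 * r₀)) :=
              Finset.sum_le_sum fun y hy => decay y (hsE hy) j
          _ = s.card * μ (ball x₀ (2 * r₀)) := by rw [Finset.sum_const, nsmul_eq_mul]
          _ ≤ _ := by gcongr
      have h2 : (2 * (P : ℝ≥0∞)) ^ j ≤ (β : ℝ≥0∞) ^ j := by
        gcongr
        exact_mod_cast hβ
      have h3 : (P : ℝ≥0∞) ^ j * (2 ^ j * μ E) ≤
          (P : ℝ≥0∞) ^ j * (N * (P : ℝ≥0∞) ^ k * μ (ball x₀ (2 * r₀))) := by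
        calc (P : ℝ≥0∞) ^ j * (2 ^ j * μ E) = (2 * (P : ℝ≥0∞)) ^ j * μ E := by
              rw [mul_pow]; ring
          _ ≤ (β : ℝ≥0∞) ^ j * μ E := by gcongr
          _ ≤ _ := h1
          _ = _ := by push_cast; rw [pow_add]; ring
      refine (ENNReal.mul_le_mul_iff_right ?_ ?_).1 h3
      · exact pow_ne_zero _ (by exact_mod_cast (by omega : P ≠ 0))
      · exact ENNReal.pow_ne_top (ENNReal.natCast_ne_top P)
    by_contra hne
    have htop : N * (P : ℝ≥0∞) ^ k * μ (ball x₀ (2 * r₀)) ≠ ∞ :=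
      ENNReal.mul_ne_top (ENNReal.mul_ne_top (ENNReal.natCast_ne_top N)
        (ENNReal.pow_ne_top (ENNReal.natCast_ne_top P))) (hfin _ _).ne
    have hlim : Filter.Tendsto (fun j : ℕ => (2 : ℝ≥0∞) ^ j * μ E) Filter.atTop
        (nhds (∞ * μ E)) :=
      ENNReal.Tendsto.mul_const (ENNReal.tendsto_pow_atTop_nhds_top_iff.2 ENNReal.one_lt_two)
        (Or.inl ENNReal.top_ne_zero)
    rw [ENNReal.top_mul hne] at hlim
    exact htop (top_le_iff.1 (le_of_tendsto' hlim bound))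
  rw [ae_iff]
  refine measure_null_of_locally_null _ fun x₀ _ => ?_
  refine ⟨_, inter_mem_nhdsWithin _ (ball_mem_nhds x₀ hr₀), ?_⟩
  refine measure_mono_null ?_ (measure_iUnion_null fun k => null x₀ k)
  rintro x ⟨hx, hx'⟩
  simp only [Set.mem_ofPred_eq, Filter.not_frequently, Filter.eventually_atTop] at hx
  obtain ⟨k, hk⟩ := hx
  exact Set.mem_iUnion.2 ⟨k, hx', hk⟩

/-! ### Differentiation along doubling balls -/

/-- A Vitali family for `μ` which consists, at the points of a set `G` of full measure, of closed
sets comparable in measure to a ball of three times their size. It is a variant of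
`Vitali.vitaliFamily`, which asks for small balls with a comparable dilate about every point. At
the points outside `G` the family consists of all closed sets with nonempty interior. -/
theorem exists_vitaliFamily_of_ae {X : Type*} [MetricSpace X] [MeasurableSpace X]
    [OpensMeasurableSpace X] [SecondCountableTopology X] (μ : Measure X)
    [IsLocallyFiniteMeasure μ] (C : NNReal) {G : Set X} (hG : μ Gᶜ = 0)
    (h : ∀ x ∈ G, ∀ ε > 0, ∃ r, 0 < r ∧ r ≤ ε ∧
      μ (closedBall x (3 * r)) ≤ C * μ (closedBall x r)) :
    ∃ v : VitaliFamily μ, ∀ x (r : ℝ), 0 < r →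
      μ (closedBall x (3 * r)) ≤ C * μ (closedBall x r) → closedBall x r ∈ v.setsAt x := by
  have hint : ∀ (x : X) (r : ℝ), 0 < r → (interior (closedBall x r)).Nonempty := fun x r hr =>
    (nonempty_ball.2 hr).mono ball_subset_interior_closedBall
  refine ⟨{
    setsAt := fun x => {a | IsClosed a ∧ (interior a).Nonempty ∧ (x ∈ G →
      ∃ r, a ⊆ closedBall x r ∧ μ (closedBall x (3 * r)) ≤ C * μ a)}
    measurableSet := fun _ _ ha => ha.1.measurableSet
    nonempty_interior := fun _ _ ha => ha.2.1
    nontrivial := ?_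
    covering := ?_ }, ?_⟩
  · intro x ε hε
    by_cases hx : x ∈ G
    · obtain ⟨r, hr, hrε, hrC⟩ := h x hx ε hε
      exact ⟨closedBall x r, ⟨isClosed_closedBall, hint x r hr, fun _ => ⟨r, subset_rfl, hrC⟩⟩,
        closedBall_subset_closedBall hrε⟩
    · exact ⟨closedBall x ε, ⟨isClosed_closedBall, hint x ε hε, fun hx' => absurd hx' hx⟩,
        subset_rfl⟩
  · intro s f fsubset ffine
    let t : Set (ℝ × X × Set X) :=
      {p | p.2.2 ⊆ closedBall p.2.1 p.1 ∧ μ (closedBall p.2.1 (3 * p.1)) ≤ C * μ p.2.2 ∧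
        (interior p.2.2).Nonempty ∧ IsClosed p.2.2 ∧ p.2.2 ∈ f p.2.1 ∧ p.2.1 ∈ s}
    have A : ∀ x ∈ s ∩ G, ∀ ε : ℝ, ε > 0 → ∃ p, p ∈ t ∧ p.1 ≤ ε ∧ p.2.1 = x := by
      intro x xs ε εpos
      obtain ⟨a, ha, h'a⟩ := ffine x xs.1 ε εpos
      obtain ⟨a_closed, a_int, hr⟩ := fsubset x xs.1 ha
      obtain ⟨r, ar, μr⟩ := hr xs.2
      refine ⟨⟨min r ε, x, a⟩, ⟨?_, ?_, a_int, a_closed, ha, xs.1⟩, min_le_right _ _, rfl⟩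
      · rcases min_cases r ε with (h' | h') <;> rwa [h'.1]
      · apply le_trans ?_ μr
        gcongr
        apply min_le_left
    obtain ⟨t', t't, -, t'_disj, μt'⟩ := Vitali.exists_disjoint_covering_ae μ (s ∩ G) t C
      (fun p => p.1) (fun p => p.2.1) (fun p => p.2.2)
      (fun p hp => hp.1) (fun p hp => hp.2.1) (fun p hp => hp.2.2.1) (fun p hp => hp.2.2.2.1) A
    refine ⟨(fun p : ℝ × X × Set X => p.2) '' t', ?_, ?_, ?_, ?_⟩
    · rintro - ⟨q, hq, rfl⟩
      exact (t't hq).2.2.2.2.2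
    · rintro p ⟨q, hq, rfl⟩ p' ⟨q', hq', rfl⟩ hqq'
      exact t'_disj hq hq' (ne_of_apply_ne _ hqq')
    · rintro - ⟨q, hq, rfl⟩
      exact (t't hq).2.2.2.2.1
    · rw [Set.biUnion_image]
      refine measure_mono_null ?_ (measure_union_null μt' hG)
      intro x hx
      by_cases hxG : x ∈ G
      · exact Or.inl ⟨⟨hx.1, hxG⟩, hx.2⟩
      · exact Or.inr hxG
  · intro x r hr hrC
    exact ⟨isClosed_closedBall, hint x r hr, fun _ => ⟨r, subset_rfl, hrC⟩⟩

/-- Lebesgue's differentiation theorem along doubling balls. -/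
theorem ae_frequently_lintegral_sub_le {X : Type*} [MetricSpace X] [MeasurableSpace X]
    [BorelSpace X] [SecondCountableTopology X] {E : Type*} [NormedAddCommGroup E]
    {μ : Measure X} (hfin : ∀ (x : X) (r : ℝ), μ (ball x r) < ∞)
    {α : ℝ} (hα : 3 < α) {β : NNReal} {r₀ : ℝ} (hr₀ : 0 < r₀)
    (hdbl : ∀ᵐ x ∂μ, ∃ᶠ i : ℕ in Filter.atTop, IsDoublingBall μ α β x (r₀ / α ^ i))
    {f : X → E} (hf : LocallyIntegrable f μ) {δ : ℝ≥0∞} (hδ : 0 < δ) :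
    ∀ᵐ x ∂μ, ∃ᶠ i : ℕ in Filter.atTop, IsDoublingBall μ α β x (r₀ / α ^ i) ∧
      ∫⁻ y in ball x (r₀ / α ^ i), ‖f y - f x‖ₑ ∂μ ≤ δ * μ (ball x (α * (r₀ / α ^ i))) := by
  have hα0 : 0 < α := by linarith
  have : IsLocallyFiniteMeasure μ :=
    ⟨fun x => ⟨ball x 1, ball_mem_nhds x one_pos, hfin x 1⟩⟩
  have hpos : ∀ i : ℕ, 0 < r₀ / α ^ i := fun i => by positivity
  have hlim : Filter.Tendsto (fun i : ℕ => r₀ / α ^ i) Filter.atTop (nhds 0) :=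
    tendsto_const_nhds.div_atTop (tendsto_pow_atTop_atTop_of_one_lt (by linarith))
  have hsub : ∀ (x : X) (i : ℕ), closedBall x (3 * (r₀ / α ^ i)) ⊆ ball x (α * (r₀ / α ^ i)) :=
    fun x i => closedBall_subset_ball (mul_lt_mul_of_pos_right hα (hpos i))
  have hcl : ∀ (x : X) (i : ℕ), IsDoublingBall μ α β x (r₀ / α ^ i) →
      μ (closedBall x (3 * (r₀ / α ^ i))) ≤ β * μ (closedBall x (r₀ / α ^ i)) := by
    intro x i hi
    refine (measure_mono (hsub x i)).trans (hi.trans ?_)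
    gcongr
    exact ball_subset_closedBall
  obtain ⟨v, hv⟩ := exists_vitaliFamily_of_ae μ β
    (G := {x | ∃ᶠ i : ℕ in Filter.atTop, IsDoublingBall μ α β x (r₀ / α ^ i)}) (ae_iff.1 hdbl) (by
    intro x hx ε hε
    obtain ⟨i, hi, hiε⟩ := (Filter.Frequently.and_eventually hx
      (hlim.eventually (Iic_mem_nhds hε))).exists
    exact ⟨r₀ / α ^ i, hpos i, hiε, hcl x i hi⟩)
  filter_upwards [hdbl, v.ae_tendsto_lintegral_enorm_sub_div hf] with x hx hxf
  obtain ⟨ε, hε, hεv⟩ := v.eventually_filterAt_iff.1 (hxf.eventually (Iio_mem_nhds hδ))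
  refine (hx.and_eventually (hlim.eventually (Iic_mem_nhds hε))).mono ?_
  rintro i ⟨hi, hiε⟩
  refine ⟨hi, ?_⟩
  have h1 := hεv _ (hv x _ (hpos i) (hcl x i hi)) (closedBall_subset_closedBall hiε)
  have hle : closedBall x (r₀ / α ^ i) ⊆ ball x (α * (r₀ / α ^ i)) :=
    (closedBall_subset_closedBall (by linarith [hpos i])).trans (hsub x i)
  have hfin' : μ (closedBall x (r₀ / α ^ i)) ≠ ∞ := ((measure_mono hle).trans_lt (hfin _ _)).ne
  calc ∫⁻ y in ball x (r₀ / α ^ i), ‖f y - f x‖ₑ ∂μ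
      ≤ ∫⁻ y in closedBall x (r₀ / α ^ i), ‖f y - f x‖ₑ ∂μ :=
        lintegral_mono_set ball_subset_closedBall
    _ ≤ δ * μ (closedBall x (r₀ / α ^ i)) := by
        by_cases h0 : μ (closedBall x (r₀ / α ^ i)) = 0
        · rw [setLIntegral_measure_zero _ _ h0]; exact zero_le
        · exact (ENNReal.div_le_iff h0 hfin').1 h1.le
    _ ≤ _ := by gcongr

/-! ### Bounds for the discrete coefficient -/

theorem IsDominatingFunction.measure_ball_lt_top {X : Type*} [MetricSpace X] [MeasurableSpace X]
    {μ : Measure X} {lam : X → ℝ → ℝ} {Clam : ℝ} (h : IsDominatingFunction μ lam Clam)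
    (x : X) (r : ℝ) : μ (ball x r) < ∞ := by
  rcases le_or_gt r 0 with hr | hr
  · simp [ball_eq_empty.2 hr]
  · exact (h.measure_ball_le x r hr).trans_lt ENNReal.ofReal_lt_top

theorem IsDominatingFunction.measureReal_ball_le {X : Type*} [MetricSpace X] [MeasurableSpace X]
    {μ : Measure X} {lam : X → ℝ → ℝ} {Clam : ℝ} (h : IsDominatingFunction μ lam Clam)
    (x : X) {r : ℝ} (hr : 0 < r) : μ.real (ball x r) ≤ lam x r :=
  ENNReal.toReal_le_of_le_ofReal (h.pos x r hr).le (h.measure_ball_le x r hr)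

theorem IsDominatingFunction.le_two_pow {X : Type*} [MetricSpace X] [MeasurableSpace X]
    {μ : Measure X} {lam : X → ℝ → ℝ} {Clam : ℝ} (h : IsDominatingFunction μ lam Clam)
    (x : X) {r : ℝ} (hr : 0 < r) (m : ℕ) : lam x (2 ^ m * r) ≤ Clam ^ m * lam x r := by
  induction m with
  | zero => simp
  | succ m ih =>
    have h1 := h.doubling x (2 ^ (m + 1) * r) (by positivity)
    have h2 : 2 ^ (m + 1) * r / 2 = 2 ^ m * r := by rw [pow_succ]; ring
    rw [h2] at h1
    calc lam x (2 ^ (m + 1) * r) ≤ Clam * lam x (2 ^ m * r) := h1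
      _ ≤ Clam * (Clam ^ m * lam x r) := mul_le_mul_of_nonneg_left ih h.const_pos.le
      _ = _ := by rw [pow_succ]; ring

section Coefficient

variable {X : Type*} [MetricSpace X] [MeasurableSpace X] {μ : Measure X} {lam : X → ℝ → ℝ}
  {Clam : ℝ}

theorem IsDominatingFunction.ratio_nonneg (h : IsDominatingFunction μ lam Clam) (x : X) {r : ℝ}
    (hr : 0 < r) : 0 ≤ μ.real (ball x r) / lam x r :=
  div_nonneg measureReal_nonneg (h.pos x r hr).le

theorem IsDominatingFunction.ratio_le_one (h : IsDominatingFunction μ lam Clam) (x : X) {r : ℝ}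
    (hr : 0 < r) : μ.real (ball x r) / lam x r ≤ 1 :=
  div_le_one_of_le₀ (h.measureReal_ball_le x hr) (h.pos x r hr).le

theorem ballGap_le {η r s : ℝ} (hη : 1 < η) (hr : 0 < r) (hs : 0 < s) {n : ℤ}
    (hn : s ≤ η ^ n * r) : ballGap η r s ≤ n :=
  (isLeast_ballGap hη hr hs).2 hn

theorem discreteCoeff_nonneg (h : IsDominatingFunction μ lam Clam) {η : ℝ} (hη : 1 < η) (x : X)
    {r : ℝ} (hr : 0 < r) (s : ℝ) : 0 ≤ discreteCoeff μ lam η x r s := by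
  refine add_nonneg zero_le_one (Finset.sum_nonneg fun k _ => h.ratio_nonneg x ?_)
  have : 0 < η := by linarith
  positivity

/-- The coefficient of two balls is at most the sum up to any exponent past the gap. -/
theorem discreteCoeff_le_sum (h : IsDominatingFunction μ lam Clam) {η : ℝ} (hη : 1 < η) (x : X)
    {r s : ℝ} (hr : 0 < r) (hs : 0 < s) {n : ℤ} (hn : s ≤ η ^ n * r) :
    discreteCoeff μ lam η x r s ≤ 1 + ∑ k ∈ Finset.Icc (-⌊Real.logb η 2⌋) n,
      μ.real (ball x (η ^ k * r)) / lam x (η ^ k * r) := by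
  have hη0 : 0 < η := by linarith
  unfold discreteCoeff
  gcongr 1 + ?_
  refine Finset.sum_le_sum_of_subset_of_nonneg
    (Finset.Icc_subset_Icc le_rfl (ballGap_le hη hr hs hn)) fun k _ _ => ?_
  exact h.ratio_nonneg x (by positivity)

theorem floor_logb_two_nonneg {η : ℝ} (hη : 1 < η) : 0 ≤ ⌊Real.logb η 2⌋ :=
  Int.floor_nonneg.2 (Real.logb_nonneg hη one_le_two)

theorem sum_ratio_le_card (h : IsDominatingFunction μ lam Clam) {η : ℝ} (hη : 1 < η) (x : X)
    {r : ℝ} (hr : 0 < r) (n : ℕ) :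
    ∑ k ∈ Finset.Icc (-⌊Real.logb η 2⌋) (n : ℤ),
      μ.real (ball x (η ^ k * r)) / lam x (η ^ k * r) ≤ ⌊Real.logb η 2⌋ + n + 1 := by
  have hη0 : 0 < η := by linarith
  have h1 := Finset.sum_le_card_nsmul (Finset.Icc (-⌊Real.logb η 2⌋) (n : ℤ))
    (fun k => μ.real (ball x (η ^ k * r)) / lam x (η ^ k * r)) 1
    fun k _ => h.ratio_le_one x (by positivity)
  refine h1.trans (le_of_eq ?_)
  have h2 := floor_logb_two_nonneg hη
  rw [nsmul_eq_mul, mul_one, Int.card_Icc, ← Int.cast_natCast, Int.toNat_of_nonneg (by omega)]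
  push_cast
  ring

theorem discreteCoeff_le_of_le (h : IsDominatingFunction μ lam Clam) {η : ℝ} (hη : 1 < η) (x : X)
    {r s : ℝ} (hr : 0 < r) (hs : 0 < s) {n : ℕ} (hn : s ≤ η ^ n * r) :
    discreteCoeff μ lam η x r s ≤ ⌊Real.logb η 2⌋ + n + 2 := by
  have h1 := discreteCoeff_le_sum h hη x hr hs (n := (n : ℤ)) (by rwa [zpow_natCast])
  have h2 := sum_ratio_le_card h hη x hr n
  linarith

/-- If none of the balls `α ^ m B`, `0 < m < J`, is doubling, where `α = η ^ M`, then the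
coefficient of `B` and `α ^ J B` is bounded independently of `J`. The ratios
`u j = μ (α ^ j B) / lam (α ^ j B)` satisfy `u j ≤ u (j + 1) / 2`, so that the partial sums of
the coefficient up to the scale `α ^ j` are at most `const + 2 M D u j`. -/
theorem discreteCoeff_le_of_not_isDoublingBall (h : IsDominatingFunction μ lam Clam) {η : ℝ}
    (hη : 1 < η) {M : ℕ} {D : ℝ}
    (hD : ∀ (x : X) (r : ℝ), 0 < r → lam x (η ^ M * r) ≤ D * lam x r)
    {β : NNReal} (hβ : 2 * D ≤ β) (x : X) {r : ℝ} (hr : 0 < r) {J : ℕ} (hJ : 0 < J)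
    (hJx : ∀ m, 0 < m → m < J → ¬ IsDoublingBall μ (η ^ M) β x ((η ^ M) ^ m * r)) :
    discreteCoeff μ lam η x r ((η ^ M) ^ J * r) ≤ ⌊Real.logb η 2⌋ + M + 2 + 2 * (M * D) := by
  have hη0 : 0 < η := by linarith
  set α := η ^ M with hα
  have hα0 : 0 < α := by positivity
  have hα1 : 1 ≤ α := one_le_pow₀ hη.le
  set a : ℤ := ⌊Real.logb η 2⌋
  have ha : 0 ≤ a := floor_logb_two_nonneg hη
  have hD0 : 0 ≤ D := by
    have h1 := (h.pos x (α * r) (by positivity)).trans_le (hD x r hr)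
    exact (pos_of_mul_pos_left h1 (h.pos x r hr).le).le
  let u : ℕ → ℝ := fun j => μ.real (ball x (α ^ j * r)) / lam x (α ^ j * r)
  have hu0 : ∀ j, 0 ≤ u j := fun j => h.ratio_nonneg x (by positivity)
  have hu1 : ∀ j, u j ≤ 1 := fun j => h.ratio_le_one x (by positivity)
  have hstep : ∀ j, 0 < j → j < J → u j ≤ u (j + 1) / 2 := by
    intro j hj hjJ
    have h1 : α * (α ^ j * r) = α ^ (j + 1) * r := by rw [pow_succ]; ring
    have h2 := hJx j hj hjJ
    rw [IsDoublingBall, not_le, h1] at h2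
    have h3 : (β : ℝ) * μ.real (ball x (α ^ j * r)) ≤ μ.real (ball x (α ^ (j + 1) * r)) := by
      have h4 := ENNReal.toReal_mono (h.measure_ball_lt_top x _).ne h2.le
      rwa [ENNReal.toReal_mul, ENNReal.coe_toReal] at h4
    have h5 := hD x (α ^ j * r) (by positivity)
    rw [h1] at h5
    have hl1 := h.pos x (α ^ j * r) (by positivity)
    have hl2 := h.pos x (α ^ (j + 1) * r) (by positivity)
    have hm := measureReal_nonneg (μ := μ) (s := ball x (α ^ j * r))
    change _ / _ ≤ _ / _ / 2
    rw [div_div, div_le_div_iff₀ hl1 (by positivity)]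
    calc μ.real (ball x (α ^ j * r)) * (lam x (α ^ (j + 1) * r) * 2)
        ≤ μ.real (ball x (α ^ j * r)) * ((D * lam x (α ^ j * r)) * 2) := by gcongr
      _ = (2 * D) * μ.real (ball x (α ^ j * r)) * lam x (α ^ j * r) := by ring
      _ ≤ β * μ.real (ball x (α ^ j * r)) * lam x (α ^ j * r) := by gcongr
      _ ≤ _ := by gcongr
  have hterm : ∀ (j : ℕ) (k : ℤ), (M * j : ℤ) < k → k ≤ M * (j + 1) →
      μ.real (ball x (η ^ k * r)) / lam x (η ^ k * r) ≤ D * u (j + 1) := by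
    intro j k hk1 hk2
    have hpow : ∀ i : ℕ, η ^ ((M * i : ℕ) : ℤ) = α ^ i := fun i => by
      rw [zpow_natCast, pow_mul]
    have hle1 : α ^ j * r ≤ η ^ k * r := by
      rw [← hpow]
      gcongr
      · exact hη.le
      · push_cast; exact hk1.le
    have hle2 : η ^ k * r ≤ α ^ (j + 1) * r := by
      rw [← hpow]
      gcongr
      · exact hη.le
      · push_cast; exact hk2
    have hl0 := h.pos x (α ^ j * r) (by positivity)
    have hl1 := h.pos x (η ^ k * r) (by positivity)
    have hl2 := h.pos x (α ^ (j + 1) * r) (by positivity)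
    have h1 : lam x (α ^ (j + 1) * r) ≤ D * lam x (η ^ k * r) := by
      have h2 := hD x (α ^ j * r) (by positivity)
      have h3 : α * (α ^ j * r) = α ^ (j + 1) * r := by rw [pow_succ]; ring
      rw [h3] at h2
      refine h2.trans ?_
      gcongr
      exact h.mono x _ _ (by positivity) hle1
    have h4 : μ.real (ball x (η ^ k * r)) ≤ μ.real (ball x (α ^ (j + 1) * r)) :=
      measureReal_mono (ball_subset_ball hle2) (h.measure_ball_lt_top x _).ne
    change _ ≤ D * (_ / _)
    rw [← mul_div_assoc, div_le_div_iff₀ hl1 hl2]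
    calc μ.real (ball x (η ^ k * r)) * lam x (α ^ (j + 1) * r)
        ≤ μ.real (ball x (α ^ (j + 1) * r)) * (D * lam x (η ^ k * r)) := by gcongr
      _ = _ := by ring
  have hsum : ∀ j : ℕ, 0 < j → j ≤ J →
      ∑ k ∈ Finset.Icc (-a) ((M * j : ℕ) : ℤ), μ.real (ball x (η ^ k * r)) / lam x (η ^ k * r) ≤
        a + M + 1 + 2 * (M * D) * u j := by
    intro j hj
    induction j, hj using Nat.le_induction with
    | base =>
      intro _
      have h1 := sum_ratio_le_card h hη x hr (M * 1)
      have h2 : 0 ≤ 2 * (M * D) * u 1 := mul_nonneg (by positivity) (hu0 1)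
      rw [mul_one] at h1
      rw [Nat.succ_eq_add_one, zero_add, mul_one]
      change _ ≤ (a : ℝ) + _ + _ at h1
      linarith
    | succ j hj ih =>
      intro hjJ
      have h1 := ih (by omega)
      have h2 := hstep j hj (by omega)
      have hunion : Finset.Icc (-a) ((M * (j + 1) : ℕ) : ℤ) =
          Finset.Icc (-a) ((M * j : ℕ) : ℤ) ∪
            Finset.Ioc ((M * j : ℕ) : ℤ) ((M * (j + 1) : ℕ) : ℤ) := by
        ext k
        simp only [Finset.mem_union, Finset.mem_Icc, Finset.mem_Ioc]
        have : ((M * j : ℕ) : ℤ) ≤ ((M * (j + 1) : ℕ) : ℤ) := by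
          exact_mod_cast Nat.mul_le_mul_left M (Nat.le_succ j)
        omega
      have hdisj : Disjoint (Finset.Icc (-a) ((M * j : ℕ) : ℤ))
          (Finset.Ioc ((M * j : ℕ) : ℤ) ((M * (j + 1) : ℕ) : ℤ)) := by
        rw [Finset.disjoint_left]
        intro k hk hk'
        rw [Finset.mem_Icc] at hk
        rw [Finset.mem_Ioc] at hk'
        omega
      rw [hunion, Finset.sum_union hdisj]
      have h3 := Finset.sum_le_card_nsmul
        (Finset.Ioc ((M * j : ℕ) : ℤ) ((M * (j + 1) : ℕ) : ℤ))
        (fun k => μ.real (ball x (η ^ k * r)) / lam x (η ^ k * r)) (D * u (j + 1)) (by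
          intro k hk
          rw [Finset.mem_Ioc] at hk
          push_cast at hk
          exact hterm j k hk.1 hk.2)
      have h4 : (Finset.Ioc ((M * j : ℕ) : ℤ) ((M * (j + 1) : ℕ) : ℤ)).card = M := by
        rw [Int.card_Ioc]
        push_cast
        rw [mul_add, mul_one, add_sub_cancel_left, Int.toNat_natCast]
      rw [h4, nsmul_eq_mul] at h3
      have h5 : (M * D) * u j ≤ (M * D) * (u (j + 1) / 2) := by gcongr
      linarith
  have h1 := discreteCoeff_le_sum h hη x hr (s := α ^ J * r) (by positivity)
    (n := ((M * J : ℕ) : ℤ)) (by rw [zpow_natCast, pow_mul])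
  have h2 := hsum J hJ le_rfl
  have h3 : 2 * (M * D) * u J ≤ 2 * (M * D) * 1 := by
    have := hu1 J
    gcongr
  change _ ≤ 1 + ∑ k ∈ Finset.Icc (-a) _, _ at h1
  linarith

end Coefficient

/-! ### The John–Nirenberg iteration -/

section JohnNirenberg

variable {X : Type*} [MetricSpace X] [MeasurableSpace X] {E : Type*}
  [NormedAddCommGroup E] {μ : Measure X}

/-- If `f` is close to both `a` and `b` in the mean over a set of positive finite measure, then
`a` and `b` are close. -/
theorem norm_sub_le_of_lintegral_le [OpensMeasurableSpace X] {f : X → E}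
    (hf : AEStronglyMeasurable f μ) {s : Set X}
    (hs0 : μ s ≠ 0) (hs : μ s ≠ ∞) {a b : E} {A B : ℝ} (hA : 0 ≤ A) (hB : 0 ≤ B)
    (h1 : ∫⁻ y in s, ‖f y - a‖ₑ ∂μ ≤ ENNReal.ofReal A * μ s)
    (h2 : ∫⁻ y in s, ‖f y - b‖ₑ ∂μ ≤ ENNReal.ofReal B * μ s) : ‖a - b‖ ≤ A + B := by
  have h3 : ENNReal.ofReal ‖a - b‖ * μ s ≤ ENNReal.ofReal (A + B) * μ s := by
    calc ENNReal.ofReal ‖a - b‖ * μ s = ∫⁻ _ in s, ‖a - b‖ₑ ∂μ := by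
          rw [setLIntegral_const, ofReal_norm]
      _ ≤ ∫⁻ y in s, (‖f y - a‖ₑ + ‖f y - b‖ₑ) ∂μ := by
          refine lintegral_mono fun y => ?_
          have h4 : a - b = (f y - b) - (f y - a) := by abel
          change ‖a - b‖ₑ ≤ ‖f y - a‖ₑ + ‖f y - b‖ₑ
          rw [h4, add_comm]
          exact enorm_sub_le
      _ = (∫⁻ y in s, ‖f y - a‖ₑ ∂μ) + ∫⁻ y in s, ‖f y - b‖ₑ ∂μ :=
          lintegral_add_left' (hf.sub aestronglyMeasurable_const).enorm.restrict _
      _ ≤ ENNReal.ofReal A * μ s + ENNReal.ofReal B * μ s := add_le_add h1 h2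
      _ = _ := by rw [← add_mul, ENNReal.ofReal_add hA hB]
  exact (ENNReal.ofReal_le_ofReal_iff (by positivity)).1
    ((ENNReal.mul_le_mul_iff_left hs0 hs).1 h3)

/-- The stopping-time argument: a point `x` of `B(x₀, r₀)` at which `f` is far from
`fB x₀ r₀` is the centre of a doubling ball `B`, small compared with `B(x₀, r₀)`, on which `f` is
still far in the mean from `fB x₀ r₀`, but such that `fB` at `5B` is within `2L` of `fB x₀ r₀`.
It is the largest doubling ball about `x`, of a radius `r₀ / α ^ i`, with `L < |f_B - f_{B₀}|`;
between it and the next larger doubling ball the numbers `fB` change by a bounded amount. -/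
theorem exists_stopping_ball {f : X → E} {fB : X → ℝ → E} {α κ A L : ℝ} {β : NNReal}
    (hα : 5 ≤ α)
    (hnear : ∀ (x y : X) (r s : ℝ), 0 < r → 0 < s → ball x r ⊆ ball y s → s ≤ α ^ 3 * r →
      ‖fB x r - fB y s‖ ≤ κ * A)
    (hchain : ∀ (x : X) (r : ℝ) (J : ℕ), 0 < r → 0 < J →
      (∀ m, 0 < m → m < J → ¬ IsDoublingBall μ α β x (α ^ m * r)) →
      ‖fB x r - fB x (α ^ J * r)‖ ≤ κ * A)
    (hκA : 0 ≤ κ * A) (hL : 4 * (κ * A) ≤ L) {x₀ x : X} {r₀ : ℝ} (hr₀ : 0 < r₀)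
    (hx : x ∈ ball x₀ r₀) (hfx : 2 * L < ‖f x - fB x₀ r₀‖)
    (hleb : ∃ i : ℕ, 0 < i ∧ IsDoublingBall μ α β x (r₀ / α ^ i) ∧
      ‖fB x (r₀ / α ^ i) - f x‖ ≤ L) :
    ∃ r : ℝ, 0 < r ∧ α * r ≤ r₀ ∧ IsDoublingBall μ α β x r ∧ L < ‖fB x r - fB x₀ r₀‖ ∧
      ‖fB x (5 * r) - fB x₀ r₀‖ ≤ 2 * L := by
  classical
  have hα0 : 0 < α := by linarith
  have hα3 : α ≤ α ^ 3 := le_self_pow₀ (by linarith) (by norm_num)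
  let Q : ℕ → Prop := fun i => 0 < i ∧ IsDoublingBall μ α β x (r₀ / α ^ i) ∧
      L < ‖fB x (r₀ / α ^ i) - fB x₀ r₀‖
  have hQ : ∃ i, Q i := by
    obtain ⟨i, hi, hdi, hfi⟩ := hleb
    refine ⟨i, hi, hdi, ?_⟩
    have h1 := norm_sub_le_norm_sub_add_norm_sub (f x) (fB x (r₀ / α ^ i)) (fB x₀ r₀)
    rw [norm_sub_rev (f x) (fB x (r₀ / α ^ i))] at h1
    linarith
  obtain ⟨hi0, hdi, hLi⟩ := Nat.find_spec hQ
  have hmin : ∀ j, j < Nat.find hQ → ¬ Q j := fun j hj => Nat.find_min hQ hj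
  set i := Nat.find hQ
  have hri : 0 < r₀ / α ^ i := by positivity
  -- `j` is the index of the next larger doubling ball, or `0` if there is none.
  let R : ℕ → Prop := fun j => j = 0 ∨ IsDoublingBall μ α β x (r₀ / α ^ j)
  let j := Nat.findGreatest R (i - 1)
  have hj : R j := Nat.findGreatest_spec (P := R) (Nat.zero_le _) (Or.inl rfl)
  have hji : j ≤ i - 1 := Nat.findGreatest_le _
  have hscale : ∀ m, m ≤ i → α ^ m * (r₀ / α ^ i) = r₀ / α ^ (i - m) := by
    intro m hm
    rw [← Nat.sub_add_cancel hm, pow_add, Nat.add_sub_cancel]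
    field_simp
  have h1 : ‖fB x (r₀ / α ^ i) - fB x (r₀ / α ^ j)‖ ≤ κ * A := by
    have h2 := hchain x (r₀ / α ^ i) (i - j) hri (by omega) (by
      intro m hm0 hm hdm
      rw [hscale m (by omega)] at hdm
      have h3 : i - m ≤ j := Nat.le_findGreatest (P := R) (by omega) (Or.inr hdm)
      omega)
    rwa [hscale _ (by omega), show i - (i - j) = j by omega] at h2
  have h2 : ‖fB x (r₀ / α ^ j) - fB x₀ r₀‖ ≤ L + 2 * (κ * A) := by
    rcases Nat.eq_zero_or_pos j with hj0 | hj0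
    · rw [hj0, pow_zero, div_one]
      have h3 := hnear x x₀ r₀ (2 * r₀) hr₀ (by positivity)
        (ball_subset_ball' (by linarith [mem_ball.1 hx])) (by gcongr; linarith)
      have h4 := hnear x₀ x₀ r₀ (2 * r₀) hr₀ (by positivity)
        (ball_subset_ball (by linarith)) (by gcongr; linarith)
      rw [norm_sub_rev] at h4
      have h5 := norm_sub_le_norm_sub_add_norm_sub (fB x r₀) (fB x₀ (2 * r₀)) (fB x₀ r₀)
      linarith
    · have h3 : ¬ L < ‖fB x (r₀ / α ^ j) - fB x₀ r₀‖ := fun hlt =>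
        hmin j (by omega) ⟨hj0, hj.resolve_left hj0.ne', hlt⟩
      linarith
  have h3 : ‖fB x (r₀ / α ^ i) - fB x (5 * (r₀ / α ^ i))‖ ≤ κ * A :=
    hnear x x _ _ hri (by positivity) (ball_subset_ball (by linarith))
      (by gcongr; linarith)
  refine ⟨r₀ / α ^ i, hri, ?_, hdi, hLi, ?_⟩
  · have h4 := hscale 1 hi0
    rw [pow_one] at h4
    rw [h4]
    exact div_le_self hr₀.le (one_le_pow₀ (by linarith))
  · rw [norm_sub_rev] at h3
    have h4 := norm_sub_le_norm_sub_add_norm_sub (fB x (5 * (r₀ / α ^ i)))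
      (fB x (r₀ / α ^ i)) (fB x₀ r₀)
    have h5 := norm_sub_le_norm_sub_add_norm_sub (fB x (r₀ / α ^ i)) (fB x (r₀ / α ^ j))
      (fB x₀ r₀)
    linarith

/-- The iteration step. The points of `B₀ = B(x₀, r₀)` with `|f - f_{B₀}| > 2 (k + 1) L` are
covered by the dilates `5B` of countably many disjoint stopping balls `B`; in `5B` they satisfy
`|f - f_{5B}| > 2 k L`. As `f` is at distance about `L` from `f_{B₀}` in the mean over each `B`, the
total measure of the stopping balls is small compared with `μ (B(x₀, ρ r₀))`. -/
theorem measure_lt_norm_sub_le_half_pow [BorelSpace X]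
    [SecondCountableTopology X] (hfin : ∀ (x : X) (r : ℝ), μ (ball x r) < ∞)
    {f : X → E} (hf : AEStronglyMeasurable f μ) {fB : X → ℝ → E} {α κ A L ρ σ : ℝ} {β : NNReal}
    (hα : 5 ≤ α) (hρ : 1 < ρ) (hαρ : 5 * ρ ≤ α) (hασ : 1 / α ≤ σ - 1) (hβ : 1 ≤ β)
    (hosc : ∀ (x : X) (r : ℝ), 0 < r →
      ∫⁻ y in ball x r, ‖f y - fB x r‖ₑ ∂μ ≤ ENNReal.ofReal A * μ (ball x (α * r)))
    (hbig : ∀ (x : X) (r : ℝ), 0 < r →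
      ∫⁻ y in ball x (σ * r), ‖f y - fB x r‖ₑ ∂μ ≤ ENNReal.ofReal (κ * A) * μ (ball x (ρ * r)))
    (hnear : ∀ (x y : X) (r s : ℝ), 0 < r → 0 < s → ball x r ⊆ ball y s → s ≤ α ^ 3 * r →
      ‖fB x r - fB y s‖ ≤ κ * A)
    (hchain : ∀ (x : X) (r : ℝ) (J : ℕ), 0 < r → 0 < J →
      (∀ m, 0 < m → m < J → ¬ IsDoublingBall μ α β x (α ^ m * r)) →
      ‖fB x r - fB x (α ^ J * r)‖ ≤ κ * A)
    (hleb : ∀ r₀ : ℝ, 0 < r₀ → ∀ᵐ x ∂μ, ∃ i : ℕ, 0 < i ∧ IsDoublingBall μ α β x (r₀ / α ^ i) ∧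
      ‖fB x (r₀ / α ^ i) - f x‖ ≤ L)
    (hA : 0 < A) (hκ : 0 ≤ κ) (hLβ : 2 * (β * A) ≤ L) (hL : 4 * (β * (κ * A)) ≤ L) (k : ℕ)
    (x₀ : X) {r₀ : ℝ} (hr₀ : 0 < r₀) :
    μ {x | x ∈ ball x₀ r₀ ∧ 2 * k * L < ‖f x - fB x₀ r₀‖} ≤
      2⁻¹ ^ k * μ (ball x₀ (ρ * r₀)) := by
  have hα0 : 0 < α := by linarith
  have hκA : 0 ≤ κ * A := by positivity
  have hβ' : (1 : ℝ) ≤ β := by exact_mod_cast hβ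
  have hL0 : 0 < L := by nlinarith
  have hL4 : 4 * (κ * A) ≤ L := by nlinarith
  induction k generalizing x₀ r₀ with
  | zero =>
    rw [pow_zero, one_mul]
    refine measure_mono fun x hx => ball_subset_ball ?_ hx.1
    nlinarith
  | succ k ih =>
    set S := {x | x ∈ ball x₀ r₀ ∧ 2 * ((k + 1 : ℕ) : ℝ) * L < ‖f x - fB x₀ r₀‖}
    let T : Set X := {x | x ∈ S ∧ ∃ i : ℕ, 0 < i ∧ IsDoublingBall μ α β x (r₀ / α ^ i) ∧
      ‖fB x (r₀ / α ^ i) - f x‖ ≤ L}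
    have hST : μ S = μ T := by
      refine measure_congr ?_
      filter_upwards [hleb r₀ hr₀] with x hx
      exact propext ⟨fun h => ⟨h, hx⟩, fun h => h.1⟩
    have hball : ∀ x ∈ T, ∃ r : ℝ, 0 < r ∧ α * r ≤ r₀ ∧ IsDoublingBall μ α β x r ∧
        L < ‖fB x r - fB x₀ r₀‖ ∧ ‖fB x (5 * r) - fB x₀ r₀‖ ≤ 2 * L := by
      intro x hx
      refine exists_stopping_ball hα hnear hchain hκA hL4 hr₀ hx.1.1 ?_ hx.2
      refine lt_of_le_of_lt ?_ hx.1.2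
      have : 0 ≤ (k : ℝ) * L := by positivity
      push_cast
      linarith
    choose! R hR0 hRr hRd hRL hR5 using hball
    obtain ⟨U, hUT, hUdisj, hUcov⟩ :=
      Vitali.exists_disjoint_subfamily_covering_enlargement_closedBall T id R r₀
        (fun x hx => by nlinarith [hRr x hx, hR0 x hx]) 4 (by norm_num)
    have hUc : U.Countable := hUdisj.countable_of_nonempty_interior fun x hx =>
      (nonempty_ball.2 (hR0 x (hUT hx))).mono ball_subset_interior_closedBall
    have hdisj : U.PairwiseDisjoint fun x => ball x (R x) := fun x hx y hy hxy =>
      (hUdisj hx hy hxy).mono ball_subset_closedBall ball_subset_closedBall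
    have hcover : T ⊆ ⋃ b ∈ U,
        {x | x ∈ ball b (5 * R b) ∧ 2 * (k : ℝ) * L < ‖f x - fB b (5 * R b)‖} := by
      intro x hx
      obtain ⟨b, hb, hxb⟩ := hUcov x hx
      have h0 := hR0 b (hUT hb)
      refine Set.mem_iUnion₂.2 ⟨b, hb, ?_, ?_⟩
      · exact closedBall_subset_ball (by linarith)
          (hxb (mem_closedBall_self (hR0 x hx).le))
      · have h1 := hx.1.2
        have h2 := hR5 b (hUT hb)
        have h3 := norm_sub_le_norm_sub_add_norm_sub (f x) (fB b (5 * R b)) (fB x₀ r₀)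
        push_cast at h1
        linarith
    have hmean : ∀ b ∈ U, ENNReal.ofReal (L / 2) * μ (ball b (R b)) ≤
        ∫⁻ y in ball b (R b), ‖f y - fB x₀ r₀‖ₑ ∂μ := by
      intro b hb
      have hbT := hUT hb
      have h1 : ENNReal.ofReal L * μ (ball b (R b)) ≤
          (∫⁻ y in ball b (R b), ‖f y - fB x₀ r₀‖ₑ ∂μ) +
            ENNReal.ofReal (L / 2) * μ (ball b (R b)) := by
        calc ENNReal.ofReal L * μ (ball b (R b))
            ≤ ∫⁻ _ in ball b (R b), ‖fB b (R b) - fB x₀ r₀‖ₑ ∂μ := by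
              rw [setLIntegral_const, ← ofReal_norm]
              gcongr
              exact (hRL b hbT).le
          _ ≤ ∫⁻ y in ball b (R b), (‖f y - fB x₀ r₀‖ₑ + ‖f y - fB b (R b)‖ₑ) ∂μ := by
              refine lintegral_mono fun y => ?_
              have h4 : fB b (R b) - fB x₀ r₀ = (f y - fB x₀ r₀) - (f y - fB b (R b)) := by abel
              change ‖fB b (R b) - fB x₀ r₀‖ₑ ≤ ‖f y - fB x₀ r₀‖ₑ + ‖f y - fB b (R b)‖ₑ
              rw [h4]
              exact enorm_sub_le
          _ = (∫⁻ y in ball b (R b), ‖f y - fB x₀ r₀‖ₑ ∂μ) +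
                ∫⁻ y in ball b (R b), ‖f y - fB b (R b)‖ₑ ∂μ :=
              lintegral_add_left' (hf.sub aestronglyMeasurable_const).enorm.restrict _
          _ ≤ _ := by
              gcongr
              calc ∫⁻ y in ball b (R b), ‖f y - fB b (R b)‖ₑ ∂μ
                  ≤ ENNReal.ofReal A * μ (ball b (α * R b)) := hosc b (R b) (hR0 b hbT)
                _ ≤ ENNReal.ofReal A * (β * μ (ball b (R b))) := by
                    gcongr
                    exact hRd b hbT
                _ = ENNReal.ofReal (β * A) * μ (ball b (R b)) := by
                    rw [ENNReal.ofReal_mul β.coe_nonneg, ENNReal.ofReal_coe_nnreal]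
                    ring
                _ ≤ _ := by
                    gcongr
                    linarith
      have h2 : ENNReal.ofReal L * μ (ball b (R b)) =
          ENNReal.ofReal (L / 2) * μ (ball b (R b)) +
            ENNReal.ofReal (L / 2) * μ (ball b (R b)) := by
        rw [← add_mul, ← ENNReal.ofReal_add (by positivity) (by positivity), add_halves]
      rw [h2] at h1
      exact (ENNReal.add_le_add_iff_right
        (ENNReal.mul_ne_top ENNReal.ofReal_ne_top (hfin _ _).ne)).1 h1
    have hsub : (⋃ b ∈ U, ball b (R b)) ⊆ ball x₀ (σ * r₀) := by
      refine Set.iUnion₂_subset fun b hb => ball_subset_ball' ?_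
      have h1 := mem_ball.1 (hUT hb).1.1
      have h2 : R b ≤ (σ - 1) * r₀ := by
        have h3 : R b ≤ r₀ / α := by
          rw [le_div_iff₀ hα0, mul_comm]; exact hRr b (hUT hb)
        calc R b ≤ 1 / α * r₀ := by rw [one_div, inv_mul_eq_div]; exact h3
          _ ≤ _ := by gcongr
      linarith
    have htotal : ENNReal.ofReal (L / 2) * ∑' b : U, μ (ball (b : X) (R b)) ≤
        ENNReal.ofReal (κ * A) * μ (ball x₀ (ρ * r₀)) := by
      rw [← ENNReal.tsum_mul_left]
      calc ∑' b : U, ENNReal.ofReal (L / 2) * μ (ball (b : X) (R b))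
          ≤ ∑' b : U, ∫⁻ y in ball (b : X) (R b), ‖f y - fB x₀ r₀‖ₑ ∂μ :=
            ENNReal.tsum_le_tsum fun b => hmean b b.2
        _ = ∫⁻ y in ⋃ b ∈ U, ball b (R b), ‖f y - fB x₀ r₀‖ₑ ∂μ :=
            (lintegral_biUnion hUc (fun _ _ => measurableSet_ball) hdisj _).symm
        _ ≤ ∫⁻ y in ball x₀ (σ * r₀), ‖f y - fB x₀ r₀‖ₑ ∂μ := lintegral_mono_set hsub
        _ ≤ _ := hbig x₀ r₀ hr₀
    have hsmall : (β : ℝ≥0∞) * ∑' b : U, μ (ball (b : X) (R b)) ≤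
        2⁻¹ * μ (ball x₀ (ρ * r₀)) := by
      have hne : ENNReal.ofReal (L / 2) ≠ 0 := by simpa using hL0
      refine (ENNReal.mul_le_mul_iff_right hne ENNReal.ofReal_ne_top).1 ?_
      calc ENNReal.ofReal (L / 2) * (β * ∑' b : U, μ (ball (b : X) (R b)))
          = β * (ENNReal.ofReal (L / 2) * ∑' b : U, μ (ball (b : X) (R b))) := by ring
        _ ≤ β * (ENNReal.ofReal (κ * A) * μ (ball x₀ (ρ * r₀))) := by gcongr
        _ = ENNReal.ofReal (β * (κ * A)) * μ (ball x₀ (ρ * r₀)) := by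
            rw [ENNReal.ofReal_mul β.coe_nonneg, ENNReal.ofReal_coe_nnreal, mul_assoc]
        _ ≤ ENNReal.ofReal (L / 2 * 2⁻¹) * μ (ball x₀ (ρ * r₀)) := by
            gcongr ENNReal.ofReal ?_ * _
            linarith
        _ = _ := by
            rw [ENNReal.ofReal_mul (by positivity), ENNReal.ofReal_inv_of_pos two_pos,
              ENNReal.ofReal_ofNat, mul_assoc]
    calc μ S = μ T := hST
      _ ≤ ∑' b : U, μ {x | x ∈ ball (b : X) (5 * R b) ∧
            2 * (k : ℝ) * L < ‖f x - fB b (5 * R b)‖} :=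
          (measure_mono hcover).trans (measure_biUnion_le μ hUc _)
      _ ≤ ∑' b : U, 2⁻¹ ^ k * (β * μ (ball (b : X) (R b))) := by
          refine ENNReal.tsum_le_tsum fun b => ?_
          have h0 := hR0 b (hUT b.2)
          refine (ih b (r₀ := 5 * R b) (by positivity)).trans ?_
          gcongr
          refine (measure_mono (ball_subset_ball ?_)).trans (hRd b (hUT b.2))
          nlinarith
      _ = 2⁻¹ ^ k * (β * ∑' b : U, μ (ball (b : X) (R b))) := by
          rw [ENNReal.tsum_mul_left, ENNReal.tsum_mul_left]
      _ ≤ 2⁻¹ ^ k * (2⁻¹ * μ (ball x₀ (ρ * r₀))) := by gcongr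
      _ = _ := by rw [pow_succ, mul_assoc]

end JohnNirenberg

/-! ### Consequences of admissibility -/

section Admissible

variable {X : Type*} [MetricSpace X] [MeasurableSpace X] {μ : Measure X} {lam : X → ℝ → ℝ}
  {Clam : ℝ} {𝕜 : Type*} [RCLike 𝕜] {η γ : ℝ} {f : X → 𝕜} {fB : X → ℝ → 𝕜} {A : ℝ}

theorem IsRBMOFamily.lintegral_le (hlam : IsDominatingFunction μ lam Clam) (hη : 1 < η)
    (h : IsRBMOFamily μ lam η γ f fB A) (x : X) {r : ℝ} (hr : 0 < r) :
    ∫⁻ y in ball x r, ‖f y - fB x r‖ₑ ∂μ ≤ ENNReal.ofReal A * μ (ball x (η * r)) := by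
  by_cases h0 : μ (ball x (η * r)) = 0
  · have h1 : μ (ball x r) = 0 :=
      measure_mono_null (ball_subset_ball (by nlinarith)) h0
    rw [setLIntegral_measure_zero _ _ h1]
    exact zero_le
  · have h1 := h.oscillation x r hr
    rw [mul_comm, ← div_eq_mul_inv] at h1
    exact (ENNReal.div_le_iff h0 (hlam.measure_ball_lt_top x _).ne).1 h1

theorem IsRBMOFamily.mono (hlam : IsDominatingFunction μ lam Clam) (hη : 1 < η)
    (h : IsRBMOFamily μ lam η γ f fB A) {A' : ℝ} (hA : A ≤ A') :
    IsRBMOFamily μ lam η γ f fB A' where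
  oscillation x r hr := (h.oscillation x r hr).trans (ENNReal.ofReal_le_ofReal hA)
  regular x y r s hr hs hsub := (h.regular x y r s hr hs hsub).trans <| by
    have := discreteCoeff_nonneg hlam hη x hr s
    gcongr

theorem IsRBMOFamily.norm_sub_le (hlam : IsDominatingFunction μ lam Clam) (hη : 1 < η)
    (hγ : 1 ≤ γ) (h : IsRBMOFamily μ lam η γ f fB A) (hA : 0 ≤ A) {K : ℝ} (x y : X) {r s : ℝ}
    (hr : 0 < r) (hs : 0 < s) (hsub : ball x r ⊆ ball y s)
    (hK : discreteCoeff μ lam η x r s ≤ K) : ‖fB x r - fB y s‖ ≤ K ^ γ * A := by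
  rw [mul_comm]
  refine (h.regular x y r s hr hs hsub).trans ?_
  have := discreteCoeff_nonneg hlam hη x hr s
  gcongr

/-- The oscillation of `f` over a slight dilate of a ball `B(x, r)` is controlled by the measure of
`B(x, ρ r)`, even if `ρ < η`: cover the dilate by boundedly many balls so small that their dilates
by the factor `η` lie in `B(x, ρ r)`, and compare all the numbers `f_B` with the one at
`B(x, ρ r)`. -/
theorem lintegral_norm_sub_dilate_le
    {α κ ρ σ : ℝ} (hη : 1 < η) (hκ : 0 ≤ κ) (hA : 0 ≤ A)
    (hσ : 1 < σ) (hρσ : σ + (σ - 1) = ρ) (hαρ : ρ ≤ α) (hασ : η * σ / (σ - 1) ≤ α)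
    {N : ℕ} (hcov : ∀ (x : X) (r : ℝ) (E : Set X), 0 < r → E ⊆ ball x r →
      ∃ s : Finset X, (s : Set X) ⊆ E ∧ s.card ≤ N ∧ E ⊆ ⋃ y ∈ s, ball y (r / α ^ 2))
    (hosc : ∀ (x : X) (r : ℝ), 0 < r →
      ∫⁻ y in ball x r, ‖f y - fB x r‖ₑ ∂μ ≤ ENNReal.ofReal A * μ (ball x (η * r)))
    (hnear : ∀ (x y : X) (r s : ℝ), 0 < r → 0 < s → ball x r ⊆ ball y s → s ≤ α ^ 3 * r →
      ‖fB x r - fB y s‖ ≤ κ * A) (x : X) {r : ℝ} (hr : 0 < r) :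
    ∫⁻ y in ball x (σ * r), ‖f y - fB x r‖ₑ ∂μ ≤
      ENNReal.ofReal (N * (1 + 2 * κ) * A) * μ (ball x (ρ * r)) := by
  have hα1 : 1 ≤ α := by linarith
  have hα0 : 0 < α := by linarith
  have hσr : 0 < σ * r := by positivity
  obtain ⟨s, hsE, hcard, hsub⟩ := hcov x (σ * r) (ball x (σ * r)) hσr subset_rfl
  set ε := σ * r / α ^ 2 with hε
  have hε0 : 0 < ε := by positivity
  have hηε : η * ε ≤ (σ - 1) * r := by
    rw [div_le_iff₀ (by linarith)] at hασ
    rw [hε, ← mul_div_assoc, div_le_iff₀ (by positivity)]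
    calc η * (σ * r) = (η * σ) * r := by ring
      _ ≤ (α * (σ - 1)) * r := by gcongr
      _ = (σ - 1) * r * α := by ring
      _ ≤ (σ - 1) * r * α ^ 2 := by
          have : 0 ≤ (σ - 1) * r := mul_nonneg (by linarith) hr.le
          gcongr
          exact le_self_pow₀ hα1 (by norm_num)
  have hsmall : ∀ y ∈ s, ball y (η * ε) ⊆ ball x (ρ * r) := by
    intro y hy
    refine ball_subset_ball' ?_
    have h1 := mem_ball.1 (hsE hy)
    rw [← hρσ]
    linarith
  have hsmall' : ∀ y ∈ s, ball y ε ⊆ ball x (ρ * r) := fun y hy =>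
    (ball_subset_ball (by nlinarith)).trans (hsmall y hy)
  have hρr : 0 < ρ * r := by
    have : 0 < ρ := by linarith
    positivity
  have hα3 : α ≤ α ^ 3 := le_self_pow₀ hα1 (by norm_num)
  have hdiff : ∀ y ∈ s, ‖fB y ε - fB x r‖ ≤ 2 * κ * A := by
    intro y hy
    have h1 := hnear y x ε (ρ * r) hε0 hρr (hsmall' y hy) (by
      have h2 : α ^ 3 * ε = α * (σ * r) := by rw [hε]; field_simp
      rw [h2]
      have h3 : r ≤ σ * r := by nlinarith
      gcongr)
    have h2 := hnear x x r (ρ * r) hr hρr (ball_subset_ball (by nlinarith)) (by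
      gcongr
      linarith)
    rw [norm_sub_rev] at h2
    have h3 := norm_sub_le_norm_sub_add_norm_sub (fB y ε) (fB x (ρ * r)) (fB x r)
    linarith
  have hone : ∀ y ∈ s, ∫⁻ z in ball y ε, ‖f z - fB x r‖ₑ ∂μ ≤
      ENNReal.ofReal ((1 + 2 * κ) * A) * μ (ball x (ρ * r)) := by
    intro y hy
    calc ∫⁻ z in ball y ε, ‖f z - fB x r‖ₑ ∂μ
        ≤ ∫⁻ z in ball y ε, (‖f z - fB y ε‖ₑ + ‖fB y ε - fB x r‖ₑ) ∂μ := by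
          refine lintegral_mono fun z => ?_
          have h4 : f z - fB x r = (f z - fB y ε) + (fB y ε - fB x r) := by abel
          change ‖f z - fB x r‖ₑ ≤ ‖f z - fB y ε‖ₑ + ‖fB y ε - fB x r‖ₑ
          rw [h4]
          exact enorm_add_le _ _
      _ = (∫⁻ z in ball y ε, ‖f z - fB y ε‖ₑ ∂μ) + ∫⁻ _ in ball y ε, ‖fB y ε - fB x r‖ₑ ∂μ :=
          lintegral_add_right' _ aemeasurable_const
      _ ≤ ENNReal.ofReal A * μ (ball x (ρ * r)) +
            ENNReal.ofReal (2 * κ * A) * μ (ball x (ρ * r)) := by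
          gcongr
          · exact (hosc y ε hε0).trans (by gcongr; exact hsmall y hy)
          · rw [setLIntegral_const, ← ofReal_norm]
            gcongr
            · exact hdiff y hy
            · exact hsmall' y hy
      _ = _ := by
          rw [← add_mul, ← ENNReal.ofReal_add hA (by positivity)]
          congr 2
          ring
  calc ∫⁻ y in ball x (σ * r), ‖f y - fB x r‖ₑ ∂μ
      ≤ ∫⁻ y in ⋃ z ∈ s, ball z ε, ‖f y - fB x r‖ₑ ∂μ := lintegral_mono_set hsub
    _ ≤ ∑ z ∈ s, ∫⁻ y in ball z ε, ‖f y - fB x r‖ₑ ∂μ := by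
        have h1 := lintegral_iUnion_le (μ := μ) (fun z : s => ball (z : X) ε)
          fun y => ‖f y - fB x r‖ₑ
        rw [tsum_fintype, Finset.sum_coe_sort s
          (fun z => ∫⁻ y in ball z ε, ‖f y - fB x r‖ₑ ∂μ), Set.iUnion_subtype] at h1
        exact h1
    _ ≤ ∑ z ∈ s, ENNReal.ofReal ((1 + 2 * κ) * A) * μ (ball x (ρ * r)) :=
        Finset.sum_le_sum hone
    _ = s.card * (ENNReal.ofReal ((1 + 2 * κ) * A) * μ (ball x (ρ * r))) := by
        rw [Finset.sum_const, nsmul_eq_mul]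
    _ ≤ N * (ENNReal.ofReal ((1 + 2 * κ) * A) * μ (ball x (ρ * r))) := by gcongr
    _ = _ := by
        rw [mul_assoc (N : ℝ), ENNReal.ofReal_mul (Nat.cast_nonneg N), ENNReal.ofReal_natCast,
          mul_assoc]

theorem ae_forall_measure_ball_ne_zero [SecondCountableTopology X] (μ : Measure X) :
    ∀ᵐ x ∂μ, ∀ r, 0 < r → μ (ball x r) ≠ 0 := by
  rw [ae_iff]
  refine measure_null_of_locally_null _ fun x hx => ?_
  simp only [Set.mem_ofPred_eq, not_forall, ne_eq, not_not] at hx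
  obtain ⟨r, hr, h0⟩ := hx
  exact ⟨_, mem_nhdsWithin_of_mem_nhds (ball_mem_nhds x hr), h0⟩

/-- The John–Nirenberg inequality for the families admissible with a positive constant. -/
theorem exists_johnNirenberg_const [BorelSpace X] (hX : GeometricallyDoubling X)
    (hlam : IsDominatingFunction μ lam Clam) (hη : 1 < η) (hγ : 1 ≤ γ) {ρ : ℝ} (hρ : 1 < ρ) :
    ∃ c : ℝ, 0 < c ∧ ∀ f : X → 𝕜, LocallyIntegrable f μ →
      ∀ (A : ℝ) (fB : X → ℝ → 𝕜), 0 < A → IsRBMOFamily μ lam η γ f fB A →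
        ∀ (x₀ : X) (r₀ t : ℝ), 0 < r₀ → 0 < t →
          μ {x | x ∈ ball x₀ r₀ ∧ t < ‖f x - fB x₀ r₀‖} ≤
            2 * μ (ball x₀ (ρ * r₀)) * ENNReal.ofReal (Real.exp (-(c * t) / A)) := by
  have := hX.secondCountableTopology
  have hη0 : 0 < η := by linarith
  have hfin := hlam.measure_ball_lt_top
  obtain ⟨N', hN'⟩ := hX
  -- The covering number may be enlarged to be positive.
  obtain ⟨N, hN1, hN⟩ : ∃ N : ℕ, 1 ≤ N ∧ ∀ (x : X) (r : ℝ), 0 < r →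
      ∃ s : Finset X, s.card ≤ N ∧ ball x r ⊆ ⋃ y ∈ s, ball y (r / 2) := by
    refine ⟨N' + 1, by omega, fun x r hr => ?_⟩
    obtain ⟨s, hs, hsub⟩ := hN' x r hr
    exact ⟨s, by omega, hsub⟩
  set σ := (1 + ρ) / 2 with hσ
  have hσ1 : 1 < σ := by rw [hσ]; linarith
  have hρσ : σ + (σ - 1) = ρ := by rw [hσ]; ring
  obtain ⟨M, hM⟩ := pow_unbounded_of_one_lt (max η (max (5 * ρ) (η * σ / (σ - 1)))) hη
  simp only [max_lt_iff] at hM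
  obtain ⟨hαη, hαρ, hασ⟩ := hM
  set α := η ^ M with hα
  have hα0 : 0 < α := by positivity
  obtain ⟨m, hm⟩ := pow_unbounded_of_one_lt α (one_lt_two)
  have hcov := fun (i : ℕ) (x : X) (r : ℝ) (E : Set X) (hr : 0 < r) (hE : E ⊆ ball x r) =>
    exists_finset_subset_cover hN hα0 hm.le i x hr hE
  set D := Clam ^ m with hD
  have hD0 : 0 < D := pow_pos hlam.const_pos m
  have hDlam : ∀ (x : X) (r : ℝ), 0 < r → lam x (α * r) ≤ D * lam x r := fun x r hr =>
    (hlam.mono x _ _ (by positivity) (by gcongr)).trans (hlam.le_two_pow x hr m)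
  set P := N ^ m with hP
  have hP1 : 1 ≤ P := Nat.one_le_pow _ _ hN1
  set β : NNReal := 1 + 2 * P + 2 * D.toNNReal with hβ
  have hβ1 : 1 ≤ β := by rw [hβ, add_assoc]; exact le_self_add
  have hβP : 2 * (P : NNReal) ≤ β := by rw [hβ, add_right_comm]; exact le_add_self
  have hβD : 2 * D ≤ β := by
    rw [hβ]
    push_cast
    rw [Real.coe_toNNReal D hD0.le]
    have : (0 : ℝ) ≤ P := Nat.cast_nonneg P
    linarith
  have hβ1' : (1 : ℝ) ≤ β := by exact_mod_cast hβ1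
  have ha : (0 : ℝ) ≤ ⌊Real.logb η 2⌋ := by exact_mod_cast floor_logb_two_nonneg hη
  set K : ℝ := ⌊Real.logb η 2⌋ + 3 * M + 2 + 2 * (M * D) with hK
  have hMD : 0 ≤ 2 * (M * D) := by positivity
  have hM0 : (0 : ℝ) ≤ M := Nat.cast_nonneg M
  have hK0 : 0 ≤ K := by rw [hK]; positivity
  set κ₀ := K ^ γ
  have hκ₀ : 0 ≤ κ₀ := Real.rpow_nonneg hK0 γ
  set κ₁ : ℝ := ((N * P ^ 2 : ℕ) : ℝ) * (1 + 2 * κ₀)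
  have hκ₁ : 0 ≤ κ₁ := by positivity
  set κ := κ₀ + κ₁
  have hκ : 0 ≤ κ := by positivity
  set Λ := 4 * (β * κ) + 2 * β
  have hΛ : 0 < Λ := by positivity
  refine ⟨Real.log 2 / (2 * Λ), by have := Real.log_pos one_lt_two; positivity, ?_⟩
  intro f hf A fB hA hfB x₀ r₀ t hr₀ ht
  have hfm := hf.aestronglyMeasurable
  have hosc := fun (x : X) (r : ℝ) (hr : 0 < r) => hfB.lintegral_le hlam hη x hr
  have hosc' : ∀ (x : X) (r : ℝ), 0 < r →
      ∫⁻ y in ball x r, ‖f y - fB x r‖ₑ ∂μ ≤ ENNReal.ofReal A * μ (ball x (α * r)) := by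
    intro x r hr
    refine (hosc x r hr).trans ?_
    gcongr
  have hnear₀ : ∀ (x y : X) (r s : ℝ), 0 < r → 0 < s → ball x r ⊆ ball y s → s ≤ α ^ 3 * r →
      ‖fB x r - fB y s‖ ≤ κ₀ * A := by
    intro x y r s hr hs hsub hsr
    refine hfB.norm_sub_le hlam hη hγ hA.le x y hr hs hsub ?_
    refine (discreteCoeff_le_of_le hlam hη x hr hs (n := M * 3) (by rwa [pow_mul])).trans ?_
    rw [hK]
    push_cast
    linarith
  have hnear : ∀ (x y : X) (r s : ℝ), 0 < r → 0 < s → ball x r ⊆ ball y s → s ≤ α ^ 3 * r →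
      ‖fB x r - fB y s‖ ≤ κ * A := by
    intro x y r s hr hs hsub hsr
    refine (hnear₀ x y r s hr hs hsub hsr).trans ?_
    gcongr
    exact le_add_of_nonneg_right hκ₁
  have hchain : ∀ (x : X) (r : ℝ) (J : ℕ), 0 < r → 0 < J →
      (∀ m, 0 < m → m < J → ¬ IsDoublingBall μ α β x (α ^ m * r)) →
      ‖fB x r - fB x (α ^ J * r)‖ ≤ κ * A := by
    intro x r J hr hJ hJx
    have h1 : ‖fB x r - fB x (α ^ J * r)‖ ≤ κ₀ * A := by
      refine hfB.norm_sub_le hlam hη hγ hA.le x x hr (by positivity) ?_ ?_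
      · refine ball_subset_ball (le_mul_of_one_le_left hr.le (one_le_pow₀ ?_))
        exact one_le_pow₀ hη.le
      · refine (discreteCoeff_le_of_not_isDoublingBall hlam hη hDlam hβD x hr hJ hJx).trans ?_
        rw [hK]
        linarith
    refine h1.trans ?_
    gcongr
    exact le_add_of_nonneg_right hκ₁
  have hbig : ∀ (x : X) (r : ℝ), 0 < r → ∫⁻ y in ball x (σ * r), ‖f y - fB x r‖ₑ ∂μ ≤
      ENNReal.ofReal (κ * A) * μ (ball x (ρ * r)) := by
    intro x r hr
    refine (lintegral_norm_sub_dilate_le hη hκ₀ hA.le hσ1 hρσ (by linarith) hασ.le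
      (hcov 2) hosc hnear₀ x hr).trans ?_
    gcongr
    exact le_add_of_nonneg_left hκ₀
  have hβL : 2 * (β * A) ≤ Λ * A := by
    have : 0 ≤ 4 * (β * κ) * A := by positivity
    calc 2 * (β * A) ≤ 4 * (β * κ) * A + 2 * (β * A) := by linarith
      _ = _ := by ring
  have hκL : 4 * (β * (κ * A)) ≤ Λ * A := by
    have : 0 ≤ 2 * β * A := by positivity
    calc 4 * (β * (κ * A)) ≤ 4 * (β * (κ * A)) + 2 * β * A := by linarith
      _ = _ := by ring
  have hleb : ∀ r₀ : ℝ, 0 < r₀ → ∀ᵐ x ∂μ, ∃ i : ℕ, 0 < i ∧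
      IsDoublingBall μ α β x (r₀ / α ^ i) ∧ ‖fB x (r₀ / α ^ i) - f x‖ ≤ Λ * A := by
    intro r₀ hr₀
    filter_upwards [ae_frequently_lintegral_sub_le hfin (by linarith) hr₀
      (ae_frequently_isDoublingBall hfin (by linarith) hP1 hcov hβP hr₀) hf
      (ENNReal.ofReal_pos.2 hA), ae_forall_measure_ball_ne_zero μ] with x hx hx0
    obtain ⟨i, ⟨hdi, hfi⟩, hi⟩ := (hx.and_eventually (Filter.eventually_gt_atTop 0)).exists
    have hr : 0 < r₀ / α ^ i := by positivity
    have hdil : ENNReal.ofReal A * μ (ball x (α * (r₀ / α ^ i))) ≤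
        ENNReal.ofReal (β * A) * μ (ball x (r₀ / α ^ i)) := by
      rw [ENNReal.ofReal_mul β.coe_nonneg, ENNReal.ofReal_coe_nnreal, mul_comm (β : ℝ≥0∞),
        mul_assoc]
      gcongr
      exact hdi
    refine ⟨i, hi, hdi, ?_⟩
    refine (norm_sub_le_of_lintegral_le hfm (hx0 _ hr) (hfin _ _).ne (by positivity)
      (by positivity) ((hosc' x _ hr).trans hdil) (hfi.trans hdil)).trans ?_
    linarith
  set L := Λ * A with hL
  have hL0 : 0 < L := by positivity
  set k := ⌊t / (2 * L)⌋₊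
  have hk1 : 2 * (k : ℝ) * L ≤ t := by
    have h1 := Nat.floor_le (a := t / (2 * L)) (by positivity)
    rw [le_div_iff₀ (by positivity)] at h1
    calc 2 * (k : ℝ) * L = k * (2 * L) := by ring
      _ ≤ t := h1
  have hk2 : t / (2 * L) < k + 1 := Nat.lt_floor_add_one _
  have hexp : (2⁻¹ : ℝ) ^ k ≤ 2 * Real.exp (-(Real.log 2 / (2 * Λ) * t) / A) := by
    have h1 : -(Real.log 2 / (2 * Λ) * t) / A = -(Real.log 2 * (t / (2 * L))) := by
      rw [hL]; field_simp
    have h2 : (2⁻¹ : ℝ) ^ (k + 1) = Real.exp (-(Real.log 2 * (k + 1))) := by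
      rw [Real.exp_neg, Real.exp_mul, Real.exp_log two_pos, inv_pow]
      congr 1
      exact_mod_cast (Real.rpow_natCast 2 (k + 1)).symm
    have h3 : (2⁻¹ : ℝ) ^ k = 2 * 2⁻¹ ^ (k + 1) := by rw [pow_succ]; ring
    rw [h1, h3, h2]
    have := Real.log_pos one_lt_two
    gcongr
  calc μ {x | x ∈ ball x₀ r₀ ∧ t < ‖f x - fB x₀ r₀‖}
      ≤ μ {x | x ∈ ball x₀ r₀ ∧ 2 * (k : ℝ) * L < ‖f x - fB x₀ r₀‖} :=
        measure_mono fun x hx => ⟨hx.1, hk1.trans_lt hx.2⟩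
    _ ≤ 2⁻¹ ^ k * μ (ball x₀ (ρ * r₀)) := by
        refine measure_lt_norm_sub_le_half_pow hfin hfm (by linarith) hρ hαρ.le ?_ hβ1 hosc'
          hbig hnear hchain hleb hA hκ hβL hκL k x₀ hr₀
        have h1 : 1 / (σ - 1) ≤ α := by
          refine le_trans ?_ hασ.le
          have : 0 < σ - 1 := by linarith
          gcongr
          nlinarith
        rw [div_le_iff₀ (by linarith)] at h1
        rwa [div_le_iff₀ hα0, mul_comm]
    _ = ENNReal.ofReal (2⁻¹ ^ k) * μ (ball x₀ (ρ * r₀)) := by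
        rw [ENNReal.ofReal_pow (by norm_num), ENNReal.ofReal_inv_of_pos two_pos,
          ENNReal.ofReal_ofNat]
    _ ≤ ENNReal.ofReal (2 * Real.exp (-(Real.log 2 / (2 * Λ) * t) / A)) *
          μ (ball x₀ (ρ * r₀)) := by gcongr
    _ = _ := by
        rw [ENNReal.ofReal_mul two_pos.le, ENNReal.ofReal_ofNat]
        ring

end Admissible

/-! ### From exponential decay to `L^p` bounds -/

/-- Integration of the exponential decay of the distribution function. -/
theorem lintegral_enorm_rpow_le_of_exp_decay {X : Type*} [MeasurableSpace X] {μ : Measure X}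
    {E : Type*} [NormedAddCommGroup E] {g : X → E} (hg : AEStronglyMeasurable g μ) {B : Set X}
    (hB : MeasurableSet B) {W : ℝ≥0∞} {b p : ℝ} (hb : 0 < b) (hp : 0 < p)
    (h : ∀ t : ℝ, 0 < t → μ {x | x ∈ B ∧ t < ‖g x‖} ≤ 2 * W * ENNReal.ofReal (Real.exp (-(b * t)))) :
    ∫⁻ x in B, ‖g x‖ₑ ^ p ∂μ ≤ ENNReal.ofReal (2 * p * ((1 / b) ^ p * Real.Gamma p)) * W := by
  have h1 : ∀ x, ‖g x‖ₑ ^ p = ENNReal.ofReal (‖g x‖ ^ p) := fun x => by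
    rw [← ofReal_norm, ENNReal.ofReal_rpow_of_nonneg (norm_nonneg _) hp.le]
  simp_rw [h1]
  rw [lintegral_rpow_eq_lintegral_meas_lt_mul (μ.restrict B) (f := fun x => ‖g x‖)
    (Filter.Eventually.of_forall fun x => norm_nonneg _)
    hg.norm.aemeasurable.restrict hp]
  have hint : IntegrableOn (fun t : ℝ => t ^ (p - 1) * Real.exp (-(b * t))) (Set.Ioi 0) := by
    have h2 := integrableOn_rpow_mul_exp_neg_mul_rpow (p := 1) (s := p - 1) (b := b)
      (by linarith) one_pos hb
    simpa only [Real.rpow_one, neg_mul] using h2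
  have h3 : ∫⁻ t in Set.Ioi (0 : ℝ), ENNReal.ofReal (t ^ (p - 1) * Real.exp (-(b * t))) =
      ENNReal.ofReal ((1 / b) ^ p * Real.Gamma p) := by
    rw [← Real.integral_rpow_mul_exp_neg_mul_Ioi hp hb, ofReal_integral_eq_lintegral_ofReal hint]
    filter_upwards [ae_restrict_mem measurableSet_Ioi] with t ht
    have ht' : (0 : ℝ) < t := ht
    positivity
  calc ENNReal.ofReal p * ∫⁻ t in Set.Ioi (0 : ℝ),
        μ.restrict B {x | t < ‖g x‖} * ENNReal.ofReal (t ^ (p - 1))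
      ≤ ENNReal.ofReal p * ∫⁻ t in Set.Ioi (0 : ℝ),
          2 * W * ENNReal.ofReal (t ^ (p - 1) * Real.exp (-(b * t))) := by
        refine mul_le_mul_right (setLIntegral_mono' measurableSet_Ioi fun t ht => ?_) _
        have ht' : (0 : ℝ) < t := ht
        rw [Measure.restrict_apply' hB, ENNReal.ofReal_mul (by positivity),
          mul_comm (ENNReal.ofReal (t ^ (p - 1))), ← mul_assoc]
        gcongr
        refine le_trans (measure_mono ?_) (h t ht')
        exact fun x hx => ⟨hx.2, hx.1⟩
    _ = ENNReal.ofReal p * (2 * W * ENNReal.ofReal ((1 / b) ^ p * Real.Gamma p)) := by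
        rw [lintegral_const_mul'' _ (by fun_prop), h3]
    _ = _ := by
        rw [mul_assoc 2 p, ENNReal.ofReal_mul two_pos.le, ENNReal.ofReal_ofNat,
          ENNReal.ofReal_mul hp.le]
        ring

/-! ### Attainment of the norm -/

section Norm

variable {X : Type*} [MetricSpace X] [MeasurableSpace X] {μ : Measure X} {lam : X → ℝ → ℝ}
  {Clam : ℝ} {𝕜 : Type*} [RCLike 𝕜] {η γ : ℝ} {f : X → 𝕜}

theorem rbmoNorm_nonneg (μ : Measure X) (lam : X → ℝ → ℝ) (η γ : ℝ) (f : X → 𝕜) :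
    0 ≤ rbmoNorm μ lam η γ f :=
  Real.sInf_nonneg fun _ hA => hA.1.le

/-- Admissible families with constants that tend to `a` have a limit along an ultrafilter, which is
admissible with the constant `a`. The values at a ball of positive measure stay bounded since they
are close to `f` in the mean; those at a null ball stay bounded by comparison with a larger ball. -/
theorem exists_isRBMOFamily_of_tendsto [BorelSpace X]
    (hlam : IsDominatingFunction μ lam Clam) (hη : 1 < η)
    (hf : AEStronglyMeasurable f μ) {a : ℝ} {u : ℕ → ℝ} {F : ℕ → X → ℝ → 𝕜}
    (hu : ∀ n, 0 ≤ u n) (hlim : Filter.Tendsto u Filter.atTop (nhds a))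
    (hF : ∀ n, IsRBMOFamily μ lam η γ f (F n) (u n)) :
    ∃ fB : X → ℝ → 𝕜, IsRBMOFamily μ lam η γ f fB a := by
  have hη0 : 0 < η := by linarith
  have hfin := hlam.measure_ball_lt_top
  have ha : 0 ≤ a := ge_of_tendsto' hlim hu
  rcases eq_or_ne μ 0 with rfl | hμ
  · refine ⟨fun _ _ => 0, fun x r _ => by simp, fun x y r s hr _ _ => ?_⟩
    rw [sub_zero, norm_zero]
    exact mul_nonneg ha (Real.rpow_nonneg (discreteCoeff_nonneg hlam hη x hr s) γ)
  obtain ⟨V, hV⟩ := hlim.bddAbove_range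
  have hV' : ∀ n, u n ≤ V := fun n => hV ⟨n, rfl⟩
  have hV0 : 0 ≤ V := (hu 0).trans (hV' 0)
  have hbdd : ∀ (x : X) (r : ℝ), 0 < r → ∃ C, ∀ n, ‖F n x r‖ ≤ C := by
    intro x r hr
    obtain ⟨R, hrR, hR⟩ : ∃ R, r ≤ R ∧ μ (ball x R) ≠ 0 := by
      by_contra! hcon
      refine hμ (Measure.measure_univ_eq_zero.1 ?_)
      rw [← iUnion_ball_nat x]
      refine measure_iUnion_null fun n => ?_
      exact measure_mono_null (ball_subset_ball (le_max_right r n)) (hcon _ (le_max_left r n))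
    have hR0 : 0 < R := hr.trans_le hrR
    set q := μ.real (ball x (η * R)) / μ.real (ball x R)
    have hq0 : 0 ≤ q := div_nonneg measureReal_nonneg measureReal_nonneg
    have hosc : ∀ n, ∫⁻ y in ball x R, ‖f y - F n x R‖ₑ ∂μ ≤
        ENNReal.ofReal (V * q) * μ (ball x R) := by
      intro n
      refine ((hF n).lintegral_le hlam hη x hR0).trans ?_
      have h1 : ENNReal.ofReal q * μ (ball x R) = μ (ball x (η * R)) := by
        have hR' : 0 < μ.real (ball x R) := ENNReal.toReal_pos hR (hfin _ _).ne
        rw [← ofReal_measureReal (hfin x R).ne, ← ENNReal.ofReal_mul hq0,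
          div_mul_cancel₀ _ hR'.ne', ofReal_measureReal (hfin _ _).ne]
      rw [ENNReal.ofReal_mul hV0, mul_assoc, h1]
      gcongr
      exact hV' n
    set κ := discreteCoeff μ lam η x r R ^ γ
    refine ⟨V * κ + (V * q + V * q) + ‖F 0 x R‖, fun n => ?_⟩
    have h1 : ‖F n x R - F 0 x R‖ ≤ V * q + V * q :=
      norm_sub_le_of_lintegral_le hf hR (hfin _ _).ne (by positivity) (by positivity)
        (hosc n) (hosc 0)
    have h2 : ‖F n x r - F n x R‖ ≤ V * κ := by
      refine ((hF n).regular x x r R hr hR0 (ball_subset_ball hrR)).trans ?_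
      have h3 : 0 ≤ κ := Real.rpow_nonneg (discreteCoeff_nonneg hlam hη x hr R) γ
      have := hV' n
      gcongr
    have h3 := norm_sub_le_norm_sub_add_norm_sub (F n x r) (F n x R) (F 0 x R)
    have h4 := norm_le_norm_sub_add (F n x r) (F 0 x R)
    linarith
  let 𝔲 : Ultrafilter ℕ := Filter.hyperfilter ℕ
  have hlim' : Filter.Tendsto u 𝔲 (nhds a) := hlim.mono_left Nat.hyperfilter_le_atTop
  have hconv : ∀ (x : X) (r : ℝ), ∃ z : 𝕜, 0 < r →
      Filter.Tendsto (fun n => F n x r) 𝔲 (nhds z) := by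
    intro x r
    by_cases hr : 0 < r
    · obtain ⟨C, hC⟩ := hbdd x r hr
      obtain ⟨z, -, hz⟩ := (isCompact_closedBall (0 : 𝕜) C).ultrafilter_le_nhds
        (𝔲.map fun n => F n x r) (by
          rw [Filter.le_principal_iff]
          exact Filter.mem_map.2 (Filter.univ_mem' fun n => mem_closedBall_zero_iff.2 (hC n)))
      exact ⟨z, fun _ => hz⟩
    · exact ⟨0, fun h => absurd h hr⟩
  choose fB hfB using hconv
  refine ⟨fB, fun x r hr => ?_, fun x y r s hr hs hsub => ?_⟩
  · rw [mul_comm, ← div_eq_mul_inv]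
    refine ENNReal.div_le_of_le_mul ?_
    have h1 : ∀ n, ∫⁻ y in ball x r, ‖f y - fB x r‖ₑ ∂μ ≤
        ENNReal.ofReal (u n) * μ (ball x (η * r)) + ‖F n x r - fB x r‖ₑ * μ (ball x r) := by
      intro n
      calc ∫⁻ y in ball x r, ‖f y - fB x r‖ₑ ∂μ
          ≤ ∫⁻ y in ball x r, (‖f y - F n x r‖ₑ + ‖F n x r - fB x r‖ₑ) ∂μ := by
            refine lintegral_mono fun y => ?_
            have h4 : f y - fB x r = (f y - F n x r) + (F n x r - fB x r) := by abel
            change ‖f y - fB x r‖ₑ ≤ ‖f y - F n x r‖ₑ + ‖F n x r - fB x r‖ₑ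
            rw [h4]
            exact enorm_add_le _ _
        _ = (∫⁻ y in ball x r, ‖f y - F n x r‖ₑ ∂μ) + ‖F n x r - fB x r‖ₑ * μ (ball x r) := by
            rw [lintegral_add_right' _ aemeasurable_const, setLIntegral_const]
        _ ≤ _ := by
            gcongr
            exact (hF n).lintegral_le hlam hη x hr
    have h2 : Filter.Tendsto (fun n => ENNReal.ofReal (u n) * μ (ball x (η * r)) +
        ‖F n x r - fB x r‖ₑ * μ (ball x r)) 𝔲
        (nhds (ENNReal.ofReal a * μ (ball x (η * r)) + 0 * μ (ball x r))) := by
      refine Filter.Tendsto.add ?_ ?_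
      · exact ENNReal.Tendsto.mul_const (ENNReal.tendsto_ofReal hlim') (Or.inr (hfin _ _).ne)
      · refine ENNReal.Tendsto.mul_const ?_ (Or.inr (hfin _ _).ne)
        have h3 := ((hfB x r hr).sub_const (fB x r)).enorm
        rwa [sub_self, enorm_zero] at h3
    rw [zero_mul, add_zero] at h2
    exact ge_of_tendsto' h2 h1
  · exact le_of_tendsto_of_tendsto' ((hfB x r hr).sub (hfB y s hs)).norm
      (hlim'.mul_const _) fun n => (hF n).regular x y r s hr hs hsub

theorem exists_isRBMOFamily_rbmoNorm [BorelSpace X] [SecondCountableTopology X]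
    (hlam : IsDominatingFunction μ lam Clam) (hη : 1 < η)
    (hf : MemRBMO μ lam η γ f) :
    ∃ fB : X → ℝ → 𝕜, IsRBMOFamily μ lam η γ f fB (rbmoNorm μ lam η γ f) := by
  obtain ⟨hfl, A, hA, hfA⟩ := hf
  obtain ⟨u, -, hlim, hu⟩ := exists_seq_tendsto_sInf
    (S := {A : ℝ | 0 < A ∧ ∃ fB : X → ℝ → 𝕜, IsRBMOFamily μ lam η γ f fB A}) ⟨A, hA, hfA⟩
    ⟨0, fun _ hA => hA.1.le⟩
  choose F hF using fun n => (hu n).2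
  exact exists_isRBMOFamily_of_tendsto hlam hη hfl.aestronglyMeasurable
    (fun n => (hu n).1.le) hlim hF

end Norm

/-! ### The John–Nirenberg inequality and its corollaries -/

theorem proposition2p16 {X : Type*} [MetricSpace X] [MeasurableSpace X] [BorelSpace X]
    {𝕜 : Type*} [RCLike 𝕜]
    (hX : GeometricallyDoubling X)
    (μ : Measure X) (lam : X → ℝ → ℝ) (Clam : ℝ) (hlam : IsDominatingFunction μ lam Clam)
    (η γ : ℝ) (hη : 1 < η) (hγ : 1 ≤ γ) (ρ : ℝ) (hρ : 1 < ρ) :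
    -- the infimum defining the norm is attained by some family of numbers
    (∀ f : X → 𝕜, MemRBMO μ lam η γ f →
      ∃ fB : X → ℝ → 𝕜, IsRBMOFamily μ lam η γ f fB (rbmoNorm μ lam η γ f)) ∧
    -- the John-Nirenberg inequality
    (∃ c : ℝ, 0 < c ∧ ∀ f : X → 𝕜, MemRBMO μ lam η γ f →
      (∀ fB : X → ℝ → 𝕜, IsRBMOFamily μ lam η γ f fB (rbmoNorm μ lam η γ f) →
        ∀ (x₀ : X) (r₀ t : ℝ), 0 < r₀ → 0 < t →
          μ {x | x ∈ ball x₀ r₀ ∧ t < ‖f x - fB x₀ r₀‖} ≤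
            2 * μ (ball x₀ (ρ * r₀)) * expDecay (c * t) (rbmoNorm μ lam η γ f)) ∧
      (∀ (A : ℝ) (fB : X → ℝ → 𝕜), 0 < A → IsRBMOFamily μ lam η γ f fB A →
        ∀ (x₀ : X) (r₀ t : ℝ), 0 < r₀ → 0 < t →
          μ {x | x ∈ ball x₀ r₀ ∧ t < ‖f x - fB x₀ r₀‖} ≤
            2 * μ (ball x₀ (ρ * r₀)) * ENNReal.ofReal (Real.exp (-(c * t) / A)))) ∧
    -- the bound for the `L^p` oscillations
    (∀ p : ℝ, 1 ≤ p → ∃ C : ℝ, 0 < C ∧ ∀ f : X → 𝕜, MemRBMO μ lam η γ f →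
      (∀ fB : X → ℝ → 𝕜, IsRBMOFamily μ lam η γ f fB (rbmoNorm μ lam η γ f) →
        ∀ (x : X) (r : ℝ), 0 < r →
          ((μ (ball x (ρ * r)))⁻¹ * ∫⁻ y in ball x r, ‖f y - fB x r‖ₑ ^ p ∂μ) ^ (1 / p) ≤
            ENNReal.ofReal (C * rbmoNorm μ lam η γ f)) ∧
      (∀ (A : ℝ) (fB : X → ℝ → 𝕜), 0 < A → IsRBMOFamily μ lam η γ f fB A →
        ∀ (x : X) (r : ℝ), 0 < r →
          ((μ (ball x (ρ * r)))⁻¹ * ∫⁻ y in ball x r, ‖f y - fB x r‖ₑ ^ p ∂μ) ^ (1 / p) ≤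
            ENNReal.ofReal (C * A))) := by
  have := hX.secondCountableTopology
  have hfin := hlam.measure_ball_lt_top
  obtain ⟨c, hc, hJN⟩ := exists_johnNirenberg_const (𝕜 := 𝕜) hX hlam hη hγ hρ
  refine ⟨fun f hf => exists_isRBMOFamily_rbmoNorm hlam hη hf,
    ⟨c, hc, fun f hf => ⟨fun fB hfB x₀ r₀ t hr₀ ht => ?_, hJN f hf.1⟩⟩, fun p hp => ?_⟩
  · rcases (rbmoNorm_nonneg μ lam η γ f).eq_or_lt' with h0 | h0
    · rw [expDecay, if_pos h0, mul_zero]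
      -- A family admissible with constant `0` is admissible with every `A > 0`; let `A → 0`.
      have hlim : Filter.Tendsto (fun A : ℝ => 2 * μ (ball x₀ (ρ * r₀)) *
          ENNReal.ofReal (Real.exp (-(c * t) / A))) (nhdsWithin 0 (Set.Ioi 0))
          (nhds (2 * μ (ball x₀ (ρ * r₀)) * ENNReal.ofReal 0)) := by
        refine ENNReal.Tendsto.const_mul (ENNReal.tendsto_ofReal ?_)
          (Or.inr (ENNReal.mul_ne_top ENNReal.ofNat_ne_top (hfin _ _).ne))
        have hneg : -(c * t) < 0 := neg_neg_of_pos (by positivity)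
        have hbot : Filter.Tendsto (fun A : ℝ => -(c * t) / A) (nhdsWithin 0 (Set.Ioi 0))
            Filter.atBot := by
          simp_rw [div_eq_mul_inv]
          exact tendsto_inv_nhdsGT_zero.const_mul_atTop_of_neg hneg
        exact Real.tendsto_exp_atBot.comp hbot
      rw [ENNReal.ofReal_zero, mul_zero] at hlim
      refine ge_of_tendsto hlim ?_
      filter_upwards [self_mem_nhdsWithin] with A hA
      exact hJN f hf.1 A fB hA (hfB.mono hlam hη (h0.le.trans (le_of_lt hA))) x₀ r₀ t hr₀ ht
    · rw [expDecay, if_neg h0.ne']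
      exact hJN f hf.1 _ fB h0 hfB x₀ r₀ t hr₀ ht
  · have hp0 : 0 < p := by linarith
    have hΓ := Real.Gamma_pos_of_pos hp0
    set C := (2 * p * Real.Gamma p) ^ (1 / p) / c with hC
    have hC0 : 0 < C := by positivity
    have hLp : ∀ f : X → 𝕜, LocallyIntegrable f μ → ∀ (A : ℝ) (fB : X → ℝ → 𝕜), 0 < A →
        IsRBMOFamily μ lam η γ f fB A → ∀ (x : X) (r : ℝ), 0 < r →
          ((μ (ball x (ρ * r)))⁻¹ * ∫⁻ y in ball x r, ‖f y - fB x r‖ₑ ^ p ∂μ) ^ (1 / p) ≤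
            ENNReal.ofReal (C * A) := by
      intro f hf A fB hA hfB x r hr
      have h1 := lintegral_enorm_rpow_le_of_exp_decay (g := fun y => f y - fB x r)
        (hf.aestronglyMeasurable.sub aestronglyMeasurable_const) measurableSet_ball
        (B := ball x r) (W := μ (ball x (ρ * r))) (b := c / A) (by positivity) hp0
        (fun t ht => by
          have h2 := hJN f hf A fB hA hfB x r t hr ht
          rwa [neg_div, ← div_mul_eq_mul_div] at h2)
      have h2 : 2 * p * ((1 / (c / A)) ^ p * Real.Gamma p) = (C * A) ^ p := by
        have h3 : ((2 * p * Real.Gamma p) ^ (1 / p)) ^ p = 2 * p * Real.Gamma p := by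
          rw [← Real.rpow_mul (by positivity), one_div_mul_cancel hp0.ne', Real.rpow_one]
        have h4 : C * A = (2 * p * Real.Gamma p) ^ (1 / p) * (1 / (c / A)) := by
          rw [hC]; field_simp
        rw [h4, Real.mul_rpow (by positivity) (by positivity), h3]
        ring
      rw [h2] at h1
      have h3 : (μ (ball x (ρ * r)))⁻¹ * ∫⁻ y in ball x r, ‖f y - fB x r‖ₑ ^ p ∂μ ≤
          ENNReal.ofReal (C * A) ^ p := by
        rw [ENNReal.ofReal_rpow_of_nonneg (by positivity) hp0.le, mul_comm, ← div_eq_mul_inv]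
        exact ENNReal.div_le_of_le_mul h1
      rw [one_div]
      exact (ENNReal.rpow_inv_le_iff hp0).2 h3
    refine ⟨C, hC0, fun f hf => ⟨fun fB hfB x r hr => ?_, hLp f hf.1⟩⟩
    have hlim : Filter.Tendsto (fun A : ℝ => ENNReal.ofReal (C * A))
        (nhdsWithin (rbmoNorm μ lam η γ f) (Set.Ioi (rbmoNorm μ lam η γ f)))
        (nhds (ENNReal.ofReal (C * rbmoNorm μ lam η γ f))) :=
      ENNReal.tendsto_ofReal
        ((Filter.tendsto_id.mono_left nhdsWithin_le_nhds).const_mul C)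
    -- Letting `A` decrease to the norm covers the case that the norm is `0`.
    refine ge_of_tendsto hlim ?_
    filter_upwards [self_mem_nhdsWithin] with A hA
    have hA' : rbmoNorm μ lam η γ f < A := hA
    exact hLp f hf.1 A fB ((rbmoNorm_nonneg μ lam η γ f).trans_lt hA')
      (hfB.mono hlam hη hA'.le) x r hr
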